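/- Let $k$ be an algebraically closed field, let $\Gamma$ be a finite acyclic quiver with vertex set $\Gamma_0$, and let $\mathcal{A}=(A_i)_{i\in\Gamma_0}$ be a family of basic finite-dimensional $k$-algebras, each with a fixed presentation $A_i\cong k\Sigma_i/\Omega_i$, where $\Sigma_i$ is a finite quiver and $\Omega_i$ an admissible ideal of $k\Sigma_i$. Let $I$ be a finite set of relations in $\Gamma$ (nonzero $k$-linear combinations of paths of length at least $2$ with common start and common end) which generates an admissible ideal $(I)$ of the path algebra $k\Gamma$; write $k\Gamma/I$ for $k\Gamma/(I)$. Modules are right modules and paths are composed from left to right. The generalized path algebra $k(\Gamma,\mathcal{A})$ is the $k$-vector space spanned by all words $a_1\beta_1a_2\beta_2\cdots a_n\beta_na_{n+1}$ with $n\ge 0$, where $\beta_1\cdots\beta_n$ is a path of $\Gamma$, $a_l$ lies in the algebra at the start of $\beta_l$ for $l\le n$, and $a_{n+1}$ lies in the algebra at the end of $\beta_n$ (for $n=0$: an element of some $A_i$), modulo $k$-linearity in each $a_l$; the product is given by concatenation, multiplying the two coefficients where the words meet, and is zero if the end of the first word is not the start of the second. Let $$\Lambda=k(\Gamma,\mathcal{A},I)=k(\Gamma,\mathcal{A})/(\mathcal{A}(I)),$$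 where $\mathcal{A}(I)$ is the set of all elements $\sum_i\lambda_i\,\beta_{i1}\overline{\gamma_{i1}}\beta_{i2}\cdots\overline{\gamma_{i(m_i-1)}}\beta_{im_i}$ such that $\sum_i\lambda_i\beta_{i1}\cdots\beta_{im_i}$ is a relation in $I$ and $\gamma_{ij}$ is a path of $\Sigma_{e(\beta_{ij})}$ (possibly trivial, all chosen independently), with residue class $\overline{\gamma_{ij}}\in A_{e(\beta_{ij})}$; here $e(\beta)$ is the end of $\beta$. A representation $M=((M_i)_{i\in\Gamma_0},(M_\alpha)_\alpha)$ of $\Lambda$ consists of an $A_i$-module $M_i$ for every vertex $i$ and a $k$-linear map $M_\alpha:M_i\to M_j$ for every arrow $\alpha:i\to j$, such that for every relation $\sum_i\lambda_i\alpha_{i1}\cdots\alpha_{in_i}$ in $I$ one has $\sum_i\lambda_i\,M_{\alpha_{in_i}}\circ\overline{\gamma_{in_i}}\circ\cdots\circ M_{\alpha_{i2}}\circ\overline{\gamma_{i2}}\circ M_{\alpha_{i1}}=0$ for all paths $\gamma_{ij}$ of the quiver $\Sigma$ at the start of $\alpha_{ij}$. It is identified with the $\Lambda$-module $\bigoplus_iM_i$,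 on which $a_1\beta_1\cdots\beta_na_{n+1}$ acts through the composite that applies $a_1$, $M_{\beta_1}$, $\dots$, $M_{\beta_n}$, $a_{n+1}$ in this order. Its support is $\operatorname{supp}M=\{i\in\Gamma_0: M_i\neq 0\}$. Let $S_i$ be the simple $k\Gamma/I$-module over the vertex $i$ (it is $k$ at $i$, zero at all other vertices, and all arrows act as zero). **Theorem.** Assume that for every vertex $i$ at which some relation of $I$ starts, and for every successor $j$ of $i$ (i.e. every end $j$ of a path of positive length starting at $i$), $$\operatorname{pd}_{k\Gamma/I}S_i\ \ge\ \operatorname{pd}_{k\Gamma/I}S_j+1 .$$ Then every representation $M$ of $\Lambda$ satisfies $$\operatorname{pd}_\Lambda M\ \le\ \max_{i\in\operatorname{supp}M}\bigl\{\operatorname{pd}_{A_i}M_i,\ \operatorname{pd}_{k\Gamma/I}S_i\bigr\},$$ where projective dimensions may be infinite, and where for $M=0$ both sides are $-\infty$. -/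

import Mathlib

open CategoryTheory MulOpposite

universe u

namespace GBP

/-! ### Generalized path algebras -/

section Paths

variable {k : Type u} [Field k] {V : Type u} [Quiver.{u} V]

/-- An `𝒜`-path from `i` to `j`: a word `a₁ β₁ a₂ ⋯ aₙ βₙ aₙ₊₁` where `β₁ ⋯ βₙ` is a path of the
quiver from `i` to `j`, `aₗ` lies in the algebra at the source of `βₗ` for `l ≤ n`, and `aₙ₊₁` lies
in the algebra at `j`. For `n = 0` it is an element of the algebra at `i = j`. -/
inductive APath (A : V → Type u) (i : V) : V → Type u
  | of (a : A i) : APath A i i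
  | cons {j l : V} (p : APath A i j) (β : j ⟶ l) (a : A l) : APath A i l

namespace APath

variable {A : V → Type u} [∀ i, Ring (A i)]

/-- Multiply the last coefficient on the right:
`a₁ β₁ ⋯ βₙ aₙ₊₁ ↦ a₁ β₁ ⋯ βₙ (aₙ₊₁ b)`. -/
def rmul {i j : V} : APath A i j → A j → APath A i j
  | of a, b => of (a * b)
  | cons p β a, b => cons p β (a * b)

/-- Concatenation:
`(a₁ β₁ ⋯ βₙ aₙ₊₁)(b₁ γ₁ ⋯ γₘ bₘ₊₁) = a₁ β₁ ⋯ βₙ (aₙ₊₁ b₁) γ₁ ⋯ γₘ bₘ₊₁`. -/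
def comp {i j l : V} (p : APath A i j) : APath A j l → APath A i l
  | of b => p.rmul b
  | cons q β b => cons (p.comp q) β b

theorem rmul_rmul {i j : V} (p : APath A i j) (a b : A j) :
    (p.rmul a).rmul b = p.rmul (a * b) := by
  cases p with
  | of c => simp [rmul, mul_assoc]
  | cons p β c => simp [rmul, mul_assoc]

theorem comp_rmul {i j l : V} (p : APath A i j) (q : APath A j l) (b : A l) :
    p.comp (q.rmul b) = (p.comp q).rmul b := by
  cases q with
  | of a => exact (rmul_rmul p a b).symm
  | cons q β a => simp [rmul, comp]

theorem comp_assoc {i j l m : V} (p : APath A i j) (q : APath A j l) (r : APath A l m) :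
    (p.comp q).comp r = p.comp (q.comp r) := by
  induction r with
  | of a => simp [comp, comp_rmul]
  | cons r β a ih => simp [comp, ih]

theorem rmul_one {i j : V} (p : APath A i j) : p.rmul 1 = p := by
  cases p <;> simp [rmul]

theorem comp_one {i j : V} (p : APath A i j) : p.comp (of 1) = p := by
  cases p <;> simp [comp, rmul]

theorem one_comp {i j : V} (p : APath A i j) : (of 1 : APath A i i).comp p = p := by
  induction p with
  | of a => simp [comp, rmul]
  | cons p β a ih => simp [comp, ih]

end APath

variable (k) (A : V → Type u) [∀ i, Ring (A i)] [∀ i, Algebra k (A i)]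

/-- The relations which make an `𝒜`-path `k`-linear in each of its coefficients. -/
inductive IsMultilinearRel (i j : V) : (APath A i j →₀ k) → Prop
  | add {l : V} (p : APath A i l) (a b : A l) (q : APath A l j) :
      IsMultilinearRel i j
        (Finsupp.single (p.comp ((APath.of (a + b)).comp q)) 1
          - Finsupp.single (p.comp ((APath.of a).comp q)) 1
          - Finsupp.single (p.comp ((APath.of b).comp q)) 1)
  | smul {l : V} (p : APath A i l) (c : k) (a : A l) (q : APath A l j) :
      IsMultilinearRel i j
        (Finsupp.single (p.comp ((APath.of (c • a)).comp q)) 1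
          - c • Finsupp.single (p.comp ((APath.of a).comp q)) 1)

/-- The `k`-vector space of `𝒜`-paths from `i` to `j`, modulo `k`-multilinearity: the component
`1ᵢ · k(Γ, 𝒜) · 1ⱼ` of the generalized path algebra. -/
abbrev PathSpace (i j : V) : Type u :=
  (APath A i j →₀ k) ⧸ Submodule.span k {x | IsMultilinearRel k A i j x}

variable {A}

/-- The class of an `𝒜`-path. -/
noncomputable def APath.cls {i j : V} (p : APath A i j) : PathSpace k A i j :=
  Submodule.Quotient.mk (Finsupp.single p 1)

variable {k}

theorem PathSpace.hom_ext {i j : V} {N : Type*} [AddCommGroup N] [Module k N]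
    {f g : PathSpace k A i j →ₗ[k] N} (h : ∀ p : APath A i j, f (p.cls k) = g (p.cls k)) :
    f = g := by
  apply Submodule.linearMap_qext
  apply Finsupp.lhom_ext'
  intro p
  ext
  exact h p

/-- A `k`-multilinear function on `𝒜`-paths induces a linear map on their span. -/
noncomputable def PathSpace.lift {i j : V} {N : Type*} [AddCommGroup N] [Module k N]
    (f : APath A i j → N)
    (hadd : ∀ (l : V) (p : APath A i l) (a b : A l) (q : APath A l j),
      f (p.comp ((APath.of (a + b)).comp q))
        = f (p.comp ((APath.of a).comp q)) + f (p.comp ((APath.of b).comp q)))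
    (hsmul : ∀ (l : V) (p : APath A i l) (c : k) (a : A l) (q : APath A l j),
      f (p.comp ((APath.of (c • a)).comp q)) = c • f (p.comp ((APath.of a).comp q))) :
    PathSpace k A i j →ₗ[k] N :=
  Submodule.liftQ _ (Finsupp.linearCombination k f) (by
    rw [Submodule.span_le]
    rintro x (⟨p, a, b, q⟩ | ⟨p, c, a, q⟩)
    · simp [hadd]
    · simp [hsmul])

theorem PathSpace.lift_cls {i j : V} {N : Type*} [AddCommGroup N] [Module k N]
    (f : APath A i j → N) (hadd) (hsmul) (p : APath A i j) :
    PathSpace.lift (k := k) f hadd hsmul (p.cls k) = f p := by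
  simp [PathSpace.lift, APath.cls]

theorem APath.cls_add {i j l : V} (p : APath A i l) (a b : A l) (q : APath A l j) :
    (p.comp ((APath.of (a + b)).comp q)).cls k
      = (p.comp ((APath.of a).comp q)).cls k + (p.comp ((APath.of b).comp q)).cls k := by
  rw [← sub_eq_zero, ← sub_sub]
  exact (Submodule.Quotient.mk_eq_zero _).2 (Submodule.subset_span (.add p a b q))

theorem APath.cls_smul {i j l : V} (p : APath A i l) (c : k) (a : A l) (q : APath A l j) :
    (p.comp ((APath.of (c • a)).comp q)).cls k = c • (p.comp ((APath.of a).comp q)).cls k := by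
  rw [← sub_eq_zero]
  exact (Submodule.Quotient.mk_eq_zero _).2 (Submodule.subset_span (.smul p c a q))

/-- The product `1ᵢ k(Γ, 𝒜) 1ⱼ × 1ⱼ k(Γ, 𝒜) 1ₗ → 1ᵢ k(Γ, 𝒜) 1ₗ` induced by concatenation. -/
noncomputable def PathSpace.comp {i j l : V} :
    PathSpace k A i j →ₗ[k] PathSpace k A j l →ₗ[k] PathSpace k A i l :=
  PathSpace.lift
    (fun p => PathSpace.lift (fun q => (p.comp q).cls k)
      (fun m r a b q => by simp only [← APath.comp_assoc p r, APath.cls_add])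
      (fun m r c a q => by simp only [← APath.comp_assoc p r, APath.cls_smul]))
    (fun m p a b q => by
      apply PathSpace.hom_ext
      intro r
      simp only [PathSpace.lift_cls, LinearMap.add_apply, APath.comp_assoc, APath.cls_add])
    (fun m p c a q => by
      apply PathSpace.hom_ext
      intro r
      simp only [PathSpace.lift_cls, LinearMap.smul_apply, APath.comp_assoc, APath.cls_smul])

theorem PathSpace.comp_cls {i j l : V} (p : APath A i j) (q : APath A j l) :
    PathSpace.comp (p.cls k) (q.cls k) = (p.comp q).cls k := by
  simp only [PathSpace.comp, PathSpace.lift_cls]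

theorem PathSpace.induction {i j : V} {P : PathSpace k A i j → Prop}
    (cls : ∀ p : APath A i j, P (p.cls k)) (zero : P 0)
    (add : ∀ x y, P x → P y → P (x + y)) (smul : ∀ (c : k) x, P x → P (c • x)) (x) : P x := by
  obtain ⟨x, rfl⟩ := Submodule.Quotient.mk_surjective _ x
  induction x using Finsupp.induction_linear with
  | zero => exact zero
  | add x y hx hy => exact add _ _ hx hy
  | single p c =>
    have := smul c _ (cls p)
    rwa [APath.cls, ← Submodule.Quotient.mk_smul, Finsupp.smul_single, smul_eq_mul, mul_one]
      at this

theorem PathSpace.comp_assoc {i j l m : V} (x : PathSpace k A i j) (y : PathSpace k A j l)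
    (z : PathSpace k A l m) :
    PathSpace.comp (PathSpace.comp x y) z = PathSpace.comp x (PathSpace.comp y z) := by
  induction x using PathSpace.induction with
  | zero => simp
  | add _ _ h₁ h₂ => simp [h₁, h₂]
  | smul _ _ h => simp [h]
  | cls p =>
    induction y using PathSpace.induction with
    | zero => simp
    | add _ _ h₁ h₂ => simp [h₁, h₂]
    | smul _ _ h => simp [h]
    | cls q =>
      induction z using PathSpace.induction with
      | zero => simp
      | add _ _ h₁ h₂ => simp [h₁, h₂]
      | smul _ _ h => simp [h]
      | cls r => simp [PathSpace.comp_cls, APath.comp_assoc]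

theorem PathSpace.comp_one {i j : V} (x : PathSpace k A i j) :
    PathSpace.comp x ((APath.of 1).cls k) = x := by
  induction x using PathSpace.induction with
  | zero => simp
  | add _ _ h₁ h₂ => simp [h₁, h₂]
  | smul _ _ h => simp [h]
  | cls p => rw [PathSpace.comp_cls, APath.comp_one]

theorem PathSpace.one_comp {i j : V} (x : PathSpace k A i j) :
    PathSpace.comp ((APath.of 1).cls k) x = x := by
  induction x using PathSpace.induction with
  | zero => simp
  | add _ _ h₁ h₂ => simp [h₁, h₂]
  | smul _ _ h => simp [h]
  | cls p => rw [PathSpace.comp_cls, APath.one_comp]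

end Paths

section Algebra

variable (k : Type u) [Field k] {V : Type u} [Quiver.{u} V]
  (A : V → Type u) [∀ i, Ring (A i)] [∀ i, Algebra k (A i)]

/-- The generalized path algebra `k(Γ, 𝒜)`: the space spanned by all `𝒜`-paths modulo
multilinearity, written as the direct sum (the vertex set is finite) over the start `i` and the end
`j` of its components. -/
def GPA : Type u := ∀ i j : V, PathSpace k A i j

noncomputable instance : AddCommGroup (GPA k A) :=
  inferInstanceAs (AddCommGroup (∀ i j : V, PathSpace k A i j))

noncomputable instance : Module k (GPA k A) :=
  inferInstanceAs (Module k (∀ i j : V, PathSpace k A i j))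

variable {k A}

/-- The component of `x` from `i` to `j`. -/
def GPA.entry (x : GPA k A) (i j : V) : PathSpace k A i j := x i j

theorem GPA.ext {x y : GPA k A} (h : ∀ i j, x.entry i j = y.entry i j) : x = y :=
  funext fun i => funext fun j => h i j

theorem GPA.add_entry (x y : GPA k A) (i j : V) :
    (x + y).entry i j = x.entry i j + y.entry i j := rfl

theorem GPA.smul_entry (c : k) (x : GPA k A) (i j : V) :
    (c • x).entry i j = c • x.entry i j := rfl

theorem GPA.zero_entry (i j : V) : (0 : GPA k A).entry i j = 0 := rfl

/-- The product of an `𝒜`-path ending at `j` with an `𝒜`-path starting at `j'` is their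
concatenation if `j = j'` and zero otherwise. -/
noncomputable instance [Fintype V] : Mul (GPA k A) where
  mul x y := fun i l => ∑ j, PathSpace.comp (x.entry i j) (y.entry j l)

theorem GPA.mul_entry [Fintype V] (x y : GPA k A) (i l : V) :
    (x * y).entry i l = ∑ j, PathSpace.comp (x.entry i j) (y.entry j l) := rfl

variable [DecidableEq V]

/-- An element of the component from `i` to `j`, as an element of `k(Γ, 𝒜)`. -/
noncomputable def PathSpace.toGPA {i j : V} (x : PathSpace k A i j) : GPA k A :=
  Pi.single i (Pi.single j x)

theorem PathSpace.toGPA_entry {i j : V} (x : PathSpace k A i j) : x.toGPA.entry i j = x := by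
  simp [PathSpace.toGPA, GPA.entry]

theorem PathSpace.toGPA_entry_of_ne {i j i' j' : V} (x : PathSpace k A i j)
    (h : i' ≠ i ∨ j' ≠ j) : x.toGPA.entry i' j' = 0 := by
  by_cases hi : i' = i
  · subst hi
    simp [PathSpace.toGPA, GPA.entry, Pi.single_eq_of_ne (h.resolve_left (by simp))]
  · simp [PathSpace.toGPA, GPA.entry, Pi.single_eq_of_ne hi]

/-- The identity is the sum of the identities of the algebras `A i`. -/
noncomputable instance : One (GPA k A) where
  one := fun i => Pi.single i ((APath.of (1 : A i)).cls k)

theorem GPA.one_entry (i : V) : (1 : GPA k A).entry i i = (APath.of (1 : A i)).cls k :=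
  Pi.single_eq_same (M := fun j => PathSpace k A i j) i _

theorem GPA.one_entry_of_ne {i j : V} (h : j ≠ i) : (1 : GPA k A).entry i j = 0 :=
  Pi.single_eq_of_ne (M := fun j => PathSpace k A i j) h _

variable [Fintype V]

noncomputable instance : Ring (GPA k A) where
  __ := (inferInstance : AddCommGroup (GPA k A))
  left_distrib x y z := GPA.ext fun i j => by
    simp [GPA.mul_entry, GPA.add_entry, Finset.sum_add_distrib]
  right_distrib x y z := GPA.ext fun i j => by
    simp [GPA.mul_entry, GPA.add_entry, Finset.sum_add_distrib]
  zero_mul x := GPA.ext fun i j => by simp [GPA.mul_entry, GPA.zero_entry]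
  mul_zero x := GPA.ext fun i j => by simp [GPA.mul_entry, GPA.zero_entry]
  mul_assoc x y z := GPA.ext fun i j => by
    simp only [GPA.mul_entry, map_sum, LinearMap.sum_apply, PathSpace.comp_assoc]
    exact Finset.sum_comm
  one_mul x := GPA.ext fun i j => by
    rw [GPA.mul_entry, Finset.sum_eq_single i]
    · rw [GPA.one_entry, PathSpace.one_comp]
    · intro l _ hl
      simp [GPA.one_entry_of_ne hl]
    · simp
  mul_one x := GPA.ext fun i j => by
    rw [GPA.mul_entry, Finset.sum_eq_single j]
    · rw [GPA.one_entry, PathSpace.comp_one]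
    · intro l _ hl
      simp [GPA.one_entry_of_ne hl.symm]
    · simp

noncomputable instance : Algebra k (GPA k A) :=
  Algebra.ofModule
    (fun c x y => GPA.ext fun i j => by
      simp [GPA.mul_entry, GPA.smul_entry, Finset.smul_sum])
    (fun c x y => GPA.ext fun i j => by
      simp [GPA.mul_entry, GPA.smul_entry, Finset.smul_sum])

end Algebra

/-! ### Ordinary path algebras, relations and admissible ideals -/

section PathAlgebra

variable (k : Type u) [Field k] {V : Type u} [Quiver.{u} V]

/-- The path algebra `kΓ`: the generalized path algebra with `k` at every vertex. -/
abbrev PathAlgebra (V : Type u) [Quiver.{u} V] : Type u := GPA k (fun _ : V => k)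

/-- A path of the quiver as an `𝒜`-path all of whose coefficients are `1`. -/
def plainAPath (A : V → Type u) [∀ i, Ring (A i)] {i j : V} : Quiver.Path i j → APath A i j
  | .nil => .of 1
  | .cons p β => .cons (plainAPath A p) β 1

/-- A path of `Γ` as an element of `kΓ`. -/
noncomputable def pathElem [DecidableEq V] {i j : V} (p : Quiver.Path i j) : PathAlgebra k V :=
  ((plainAPath (fun _ : V => k) p).cls k).toGPA

/-- A relation in a quiver: a nonzero `k`-linear combination of paths of length at least two which
have the same start and the same end. -/
structure QuiverRelation (V : Type u) [Quiver.{u} V] where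
  source : V
  target : V
  coeff : Quiver.Path source target →₀ k
  ne_zero : coeff ≠ 0
  two_le_length : ∀ p ∈ coeff.support, 2 ≤ p.length

variable {k}

/-- A relation as an element of `kΓ`. -/
noncomputable def QuiverRelation.toPathAlgebra [DecidableEq V] (ρ : QuiverRelation k V) :
    PathAlgebra k V :=
  ρ.coeff.sum fun p c => c • pathElem k p

variable [DecidableEq V] [Fintype V]

variable (k V) in
/-- The `m`-th power of the arrow ideal of `kΓ`: the two-sided ideal generated by the paths of
length `m`. -/
noncomputable def arrowIdealPow (m : ℕ) : TwoSidedIdeal (PathAlgebra k V) :=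
  TwoSidedIdeal.span {x | ∃ (i j : V) (p : Quiver.Path i j), p.length = m ∧ x = pathElem k p}

/-- Admissible ideals `J` of `kΓ`: `Rᵐ ⊆ J ⊆ R²` for some `m ≥ 2`, where `R` is the arrow ideal. -/
def IsAdmissible (J : TwoSidedIdeal (PathAlgebra k V)) : Prop :=
  (∃ m, 2 ≤ m ∧ arrowIdealPow k V m ≤ J) ∧ J ≤ arrowIdealPow k V 2

end PathAlgebra

/-- A presentation of a `k`-algebra `A` as a bound quiver algebra `kΣ/Ω` with `Σ` a finite quiver
and `Ω` an admissible ideal of `kΣ`, given by the surjection `kΣ → A` with kernel `Ω`. Over an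
algebraically closed field such a presentation exists exactly for the basic finite-dimensional
algebras. -/
structure Presentation (k : Type u) [Field k] (A : Type u) [Ring A] [Algebra k A] where
  Q : Type u
  [quiver : Quiver.{u} Q]
  [fintype : Fintype Q]
  [decEq : DecidableEq Q]
  finite_hom : ∀ i j : Q, Finite (i ⟶ j)
  proj : PathAlgebra k Q →ₐ[k] A
  surjective : Function.Surjective proj
  admissible : IsAdmissible (TwoSidedIdeal.ker proj)

attribute [instance] Presentation.quiver Presentation.fintype Presentation.decEq

/-- The residue classes `γ̄ ∈ A` of the paths `γ` of `Σ`. -/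
def Presentation.residues {k : Type u} [Field k] {A : Type u} [Ring A] [Algebra k A]
    (P : Presentation k A) : Set A :=
  {a | ∃ (x y : P.Q) (γ : Quiver.Path x y), a = P.proj (pathElem k γ)}

/-! ### Generalized bound path algebras

In this section `B i` is a set of elements of `A i`, which is the set of residue classes of the
paths of `Σᵢ` when `A i ≅ kΣᵢ/Ωᵢ`. -/

section Bound

variable {k : Type u} [Field k] {V : Type u} [Quiver.{u} V]
  {A : V → Type u} [∀ i, Ring (A i)] [∀ i, Algebra k (A i)]

/-- `IsInsertion B p x`: the `𝒜`-path `x` is of the form `1 β₁ γ₁ β₂ γ₂ ⋯ γₘ₋₁ βₘ 1`, where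
`p = β₁ β₂ ⋯ βₘ` has length `m ≥ 1` and each `γₗ` belongs to `B` at the end of `βₗ`. -/
inductive IsInsertion (B : ∀ i, Set (A i)) {i : V} :
    ∀ {j : V}, Quiver.Path i j → APath A i j → Prop
  | single {j : V} (β : i ⟶ j) :
      IsInsertion B (Quiver.Path.nil.cons β) ((APath.of 1).cons β 1)
  | cons {j l : V} (p : Quiver.Path i j) (x : APath A i j) (γ : A j) (β : j ⟶ l) :
      IsInsertion B p x → γ ∈ B j → IsInsertion B (p.cons β) ((x.rmul γ).cons β 1)

/-- A simultaneous choice of insertions for all the paths that occur in a relation (the choices for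
different paths are independent of each other). -/
def QuiverRelation.IsChoice (ρ : QuiverRelation k V) (B : ∀ i, Set (A i))
    (c : Quiver.Path ρ.source ρ.target → APath A ρ.source ρ.target) : Prop :=
  ∀ p ∈ ρ.coeff.support, IsInsertion B p (c p)

variable [DecidableEq V] [Fintype V]

/-- The set `𝒜(I)` of all `∑ᵢ λᵢ βᵢ₁ γᵢ₁ βᵢ₂ ⋯ γᵢ₍ₘᵢ₋₁₎ βᵢₘᵢ` where
`∑ᵢ λᵢ βᵢ₁ ⋯ βᵢₘᵢ` is a relation in `I` and the `γᵢⱼ` are in `B`. -/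
def relators (B : ∀ i, Set (A i)) (I : Set (QuiverRelation k V)) : Set (GPA k A) :=
  {x | ∃ ρ ∈ I, ∃ c : Quiver.Path ρ.source ρ.target → APath A ρ.source ρ.target,
    ρ.IsChoice B c ∧ x = (ρ.coeff.sum fun p r => r • (c p).cls k).toGPA}

/-- The generalized bound path algebra `k(Γ, 𝒜, I) = k(Γ, 𝒜) / (𝒜(I))`. -/
abbrev GBPA (B : ∀ i, Set (A i)) (I : Set (QuiverRelation k V)) : Type u :=
  (TwoSidedIdeal.span (relators B I)).ringCon.Quotient

end Bound

/-! ### Representations -/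

section Rep

variable (k : Type u) [Field k] {V : Type u} [Quiver.{u} V]
  (A : V → Type u) [∀ i, Ring (A i)] [∀ i, Algebra k (A i)]

/-- The data of a representation, without relations: a right `A i`-module at each vertex `i` and a
`k`-linear map for each arrow. -/
structure PreRep where
  obj : V → Type u
  [addCommGroup : ∀ i, AddCommGroup (obj i)]
  [kModule : ∀ i, Module k (obj i)]
  [rightModule : ∀ i, Module (A i)ᵐᵒᵖ (obj i)]
  [isScalarTower : ∀ i, IsScalarTower k (A i)ᵐᵒᵖ (obj i)]
  map : ∀ {i j : V}, (i ⟶ j) → obj i →ₗ[k] obj j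

attribute [instance] PreRep.addCommGroup PreRep.kModule PreRep.rightModule PreRep.isScalarTower

variable {k A}

namespace PreRep

variable (M : PreRep k A)

/-- The right action of `a : A i` on `M i`. -/
def act (i : V) (a : A i) : M.obj i →ₗ[k] M.obj i where
  toFun m := op a • m
  map_add' := smul_add _
  map_smul' c m := by
    have h : ∀ n : M.obj i, c • n = op (algebraMap k (A i) c) • n := fun n => by
      rw [← one_smul (A i)ᵐᵒᵖ n, ← smul_assoc, ← smul_assoc, Algebra.algebraMap_eq_smul_one]
      simp
    rw [RingHom.id_apply, h, h, ← mul_smul, ← mul_smul, ← op_mul, ← op_mul, Algebra.commutes]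

theorem act_apply (i : V) (a : A i) (m : M.obj i) : M.act i a m = op a • m := rfl

/-- The map `M i → M j` given by an `𝒜`-path `a₁ β₁ ⋯ βₙ aₙ₊₁`, that is, the composite (from
right to left) `aₙ₊₁ ∘ M_{βₙ} ∘ ⋯ ∘ M_{β₁} ∘ a₁`. -/
def pathMap {i : V} : ∀ {j : V}, APath A i j → (M.obj i →ₗ[k] M.obj j)
  | _, .of a => M.act i a
  | _, .cons p β a => M.act _ a ∘ₗ M.map β ∘ₗ pathMap p

theorem act_mul (i : V) (a b : A i) : M.act i (a * b) = M.act i b ∘ₗ M.act i a := by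
  ext m
  simp [act_apply, mul_smul]

theorem pathMap_rmul {i j : V} (p : APath A i j) (b : A j) :
    M.pathMap (p.rmul b) = M.act j b ∘ₗ M.pathMap p := by
  cases p <;> simp [APath.rmul, pathMap, act_mul, LinearMap.comp_assoc]

theorem pathMap_comp {i j l : V} (p : APath A i j) (q : APath A j l) :
    M.pathMap (p.comp q) = M.pathMap q ∘ₗ M.pathMap p := by
  induction q with
  | of a => exact M.pathMap_rmul p a
  | cons q β a ih => simp [APath.comp, pathMap, ih, LinearMap.comp_assoc]

theorem act_add (i : V) (a b : A i) : M.act i (a + b) = M.act i a + M.act i b := by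
  ext m
  simp [act_apply, add_smul]

theorem act_smul (i : V) (c : k) (a : A i) : M.act i (c • a) = c • M.act i a := by
  ext m
  simp [act_apply]

/-- The action of `1ᵢ k(Γ, 𝒜) 1ⱼ` as `k`-linear maps `M i → M j`. -/
noncomputable def toHom (i j : V) : PathSpace k A i j →ₗ[k] (M.obj i →ₗ[k] M.obj j) :=
  PathSpace.lift M.pathMap
    (fun l p a b q => by
      simp [pathMap_comp, pathMap, act_add, LinearMap.comp_add, LinearMap.add_comp])
    (fun l p c a q => by
      simp [pathMap_comp, pathMap, act_smul, LinearMap.comp_smul, LinearMap.smul_comp])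

theorem toHom_cls {i j : V} (p : APath A i j) : M.toHom i j (p.cls k) = M.pathMap p := by
  simp [toHom, PathSpace.lift_cls]

theorem toHom_comp {i j l : V} (x : PathSpace k A i j) (y : PathSpace k A j l) :
    M.toHom i l (PathSpace.comp x y) = M.toHom j l y ∘ₗ M.toHom i j x := by
  induction x using PathSpace.induction with
  | zero => simp
  | add _ _ h₁ h₂ => simp [h₁, h₂, LinearMap.comp_add]
  | smul _ _ h => simp [h, LinearMap.comp_smul]
  | cls p =>
    induction y using PathSpace.induction with
    | zero => simp
    | add _ _ h₁ h₂ => simp [h₁, h₂, LinearMap.add_comp]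
    | smul _ _ h => simp [h, LinearMap.smul_comp]
    | cls q => simp [PathSpace.comp_cls, toHom_cls, pathMap_comp]

variable [Fintype V]

/-- The right action of `k(Γ, 𝒜)` on `⨁ i, M i`: for `x` in the component from `i` to `j`, the
element `m · x` is the image of the `i`-th component of `m` under `x`, placed at `j`. -/
noncomputable def gpaEnd (x : GPA k A) : AddMonoid.End (∀ i, M.obj i) where
  toFun m := fun j => ∑ i, M.toHom i j (x.entry i j) (m i)
  map_zero' := by ext; simp
  map_add' m n := by ext; simp [Finset.sum_add_distrib]

theorem gpaEnd_apply (x : GPA k A) (m : ∀ i, M.obj i) (j : V) :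
    M.gpaEnd x m j = ∑ i, M.toHom i j (x.entry i j) (m i) := rfl

variable [DecidableEq V]

/-- The right action of `k(Γ, 𝒜)` on `⨁ i, M i` as a ring homomorphism. -/
noncomputable def gpaAction : GPA k A →+* (AddMonoid.End (∀ i, M.obj i))ᵐᵒᵖ where
  toFun x := op (M.gpaEnd x)
  map_zero' := by
    apply unop_injective
    refine AddMonoidHom.ext fun m => funext fun j => ?_
    exact (M.gpaEnd_apply 0 m j).trans
      (Finset.sum_eq_zero fun i _ => by rw [GPA.zero_entry, map_zero, LinearMap.zero_apply])
  map_add' x y := by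
    apply unop_injective
    refine AddMonoidHom.ext fun m => funext fun j => ?_
    refine (M.gpaEnd_apply (x + y) m j).trans ?_
    simp only [GPA.add_entry, map_add, LinearMap.add_apply, Finset.sum_add_distrib]
    rfl
  map_one' := by
    apply unop_injective
    refine AddMonoidHom.ext fun m => funext fun j => ?_
    refine (M.gpaEnd_apply 1 m j).trans ?_
    rw [Finset.sum_eq_single j]
    · rw [GPA.one_entry, toHom_cls]
      exact one_smul (A j)ᵐᵒᵖ (m j)
    · intro i _ hi
      simp [GPA.one_entry_of_ne hi.symm]
    · simp
  map_mul' x y := by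
    apply unop_injective
    refine AddMonoidHom.ext fun m => funext fun j => ?_
    refine (M.gpaEnd_apply (x * y) m j).trans ?_
    refine Eq.trans ?_ (M.gpaEnd_apply y (M.gpaEnd x m) j).symm
    simp only [gpaEnd_apply, GPA.mul_entry, map_sum, LinearMap.sum_apply, toHom_comp,
      LinearMap.comp_apply]
    exact Finset.sum_comm

theorem gpaAction_apply (x : GPA k A) (m : ∀ i, M.obj i) (j : V) :
    (M.gpaAction x).unop m j = ∑ i, M.toHom i j (x.entry i j) (m i) := rfl

end PreRep

/-- A representation of `k(Γ, 𝒜, I)`: every relation `∑ᵢ λᵢ αᵢ₁ ⋯ αᵢₙᵢ` in `I` is satisfied, in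
the sense that `∑ᵢ λᵢ M_{αᵢₙᵢ} ∘ γᵢₙᵢ ∘ ⋯ ∘ M_{αᵢ₂} ∘ γᵢ₂ ∘ M_{αᵢ₁} = 0` for every choice of
elements `γᵢⱼ` of `B` at the source of `αᵢⱼ`. -/
structure Rep (B : ∀ i, Set (A i)) (I : Set (QuiverRelation k V)) extends PreRep k A where
  map_relation : ∀ ρ ∈ I, ∀ c : Quiver.Path ρ.source ρ.target → APath A ρ.source ρ.target,
    ρ.IsChoice B c → (ρ.coeff.sum fun p r => r • toPreRep.pathMap (c p)) = 0

namespace Rep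

variable {B : ∀ i, Set (A i)} {I : Set (QuiverRelation k V)}

/-- The support: the set of vertices `i` with `M i ≠ 0`. -/
def supp (M : Rep B I) : Set V := {i | Nontrivial (M.obj i)}

variable [DecidableEq V] [Fintype V]

/-- The right action of `k(Γ, 𝒜, I)` on `⨁ i, M i`. -/
noncomputable def gbpaAction (M : Rep B I) :
    GBPA B I →+* (AddMonoid.End (∀ i, M.obj i))ᵐᵒᵖ :=
  RingCon.lift _ M.gpaAction (by
    have h : TwoSidedIdeal.span (relators B I) ≤ TwoSidedIdeal.ker M.gpaAction := by
      rw [TwoSidedIdeal.span_le]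
      rintro _ ⟨ρ, hρ, c, hc, rfl⟩
      have h0 := M.map_relation ρ hρ c hc
      have h1 : M.toHom _ _ (ρ.coeff.sum fun p r => r • (c p).cls k) = 0 := by
        rw [← h0, map_finsuppSum]
        simp [PreRep.toHom_cls]
      rw [SetLike.mem_coe, TwoSidedIdeal.mem_ker]
      apply unop_injective
      refine AddMonoidHom.ext fun m => funext fun j => ?_
      refine (M.gpaAction_apply _ m j).trans ?_
      rw [Finset.sum_eq_single ρ.source]
      · by_cases hj : j = ρ.target
        · subst hj
          rw [PathSpace.toGPA_entry, h1]
          rfl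
        · rw [PathSpace.toGPA_entry_of_ne _ (Or.inr hj), map_zero]
          rfl
      · intro i _ hi
        rw [PathSpace.toGPA_entry_of_ne _ (Or.inl hi), map_zero]
        rfl
      · simp
    intro x y hxy
    have := h ((TwoSidedIdeal.rel_iff _ x y).1 hxy)
    rw [TwoSidedIdeal.mem_ker, map_sub, sub_eq_zero] at this
    exact this)

/-- The space `⨁ i, M i` which underlies the right `k(Γ, 𝒜, I)`-module of `M`. -/
def total (M : Rep B I) : Type u := ∀ i, M.obj i

noncomputable instance (M : Rep B I) : AddCommGroup M.total :=
  inferInstanceAs (AddCommGroup (∀ i, M.obj i))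

/-- The right `k(Γ, 𝒜, I)`-module which corresponds to a representation. -/
noncomputable instance (M : Rep B I) : Module (GBPA B I)ᵐᵒᵖ M.total :=
  letI : Module (AddMonoid.End (∀ i, M.obj i)) M.total :=
    inferInstanceAs (Module (AddMonoid.End (∀ i, M.obj i)) (∀ i, M.obj i))
  Module.compHom M.total
    ((RingEquiv.opOp (AddMonoid.End (∀ i, M.obj i))).symm.toRingHom.comp M.gbpaAction.op)

theorem op_mk_smul (M : Rep B I) (x : GPA k A) (m : M.total) (j : V) :
    ((op ((x : GPA k A) : GBPA B I) : (GBPA B I)ᵐᵒᵖ) • m) j = ∑ i, M.toHom i j (x.entry i j) (m i) := rfl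

end Rep

end Rep

/-! ### Projective dimensions -/

/-- The projective dimension of a right `R`-module (`⊥` for the zero module). -/
noncomputable def rightPd (R : Type u) [Ring R] (M : Type u) [AddCommGroup M] [Module Rᵐᵒᵖ M] :
    WithBot ℕ∞ :=
  projectiveDimension (ModuleCat.of Rᵐᵒᵖ M)

section Simple

variable {k : Type u} [Field k] {V : Type u} [Quiver.{u} V]

/-- The field `k` is presented by the quiver with one vertex and no arrows, whose only path is the
trivial one, with residue class `1`. -/
abbrev unitResidues (k : Type u) [Field k] (V : Type u) : V → Set k := fun _ => {1}

/-- The bound path algebra `kΓ/I`. -/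
abbrev BoundPathAlgebra [DecidableEq V] [Fintype V] (I : Set (QuiverRelation k V)) : Type u :=
  GBPA (A := fun _ : V => k) (unitResidues k V) I

theorem isInsertion_unitResidues {i j : V} {p : Quiver.Path i j}
    {x : APath (fun _ : V => k) i j} (h : IsInsertion (unitResidues k V) p x) :
    x = plainAPath (fun _ : V => k) p := by
  induction h with
  | single β => rfl
  | @cons j l p x γ β hx hγ ih =>
    have hγ : γ = 1 := hγ
    subst hγ ih
    exact congrArg (fun y : APath (fun _ : V => k) i j => y.cons β 1) (APath.rmul_one _)

theorem isInsertion_plainAPath {i j : V} (p : Quiver.Path i j) (hp : 0 < p.length) :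
    IsInsertion (unitResidues k V) p (plainAPath (fun _ : V => k) p) := by
  induction p with
  | nil => simp at hp
  | @cons j l p β ih =>
    cases p with
    | nil => exact .single β
    | cons p β' =>
      have := IsInsertion.cons _ _ (1 : k) β (ih (by simp)) (B := unitResidues k V) rfl
      rwa [show APath.rmul (plainAPath (fun _ : V => k) (p.cons β')) (1 : k)
        = plainAPath (fun _ : V => k) (p.cons β') from APath.rmul_one _] at this

/-- The ideal that defines `BoundPathAlgebra I` is the ideal of `kΓ` generated by `I`. -/
theorem relators_unitResidues [DecidableEq V] (I : Set (QuiverRelation k V)) :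
    relators (A := fun _ : V => k) (unitResidues k V) I
      = QuiverRelation.toPathAlgebra '' I := by
  have key (ρ : QuiverRelation k V)
      (c : Quiver.Path ρ.source ρ.target → APath (fun _ : V => k) ρ.source ρ.target)
      (hc : ∀ p ∈ ρ.coeff.support, c p = plainAPath _ p) :
      (ρ.coeff.sum fun p r => r • (c p).cls k).toGPA = ρ.toPathAlgebra := by
    have h : (ρ.coeff.sum fun p r => r • (c p).cls k)
        = ρ.coeff.sum fun p r => r • (plainAPath (fun _ : V => k) p).cls k :=
      Finset.sum_congr rfl fun p hp => by simp only [hc p hp]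
    rw [h]
    let T : PathSpace k (fun _ : V => k) ρ.source ρ.target →ₗ[k] PathAlgebra k V :=
      (LinearMap.single k (fun i => ∀ j, PathSpace k (fun _ : V => k) i j) ρ.source) ∘ₗ
        LinearMap.single k (fun j => PathSpace k (fun _ : V => k) ρ.source j) ρ.target
    exact (map_finsuppSum T _ _).trans (Finset.sum_congr rfl fun p _ => map_smul T _ _)
  ext x
  constructor
  · rintro ⟨ρ, hρ, c, hc, rfl⟩
    exact ⟨ρ, hρ, (key ρ c fun p hp => isInsertion_unitResidues (hc p hp)).symm⟩
  · rintro ⟨ρ, hρ, rfl⟩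
    exact ⟨ρ, hρ, plainAPath _,
      fun p hp => isInsertion_plainAPath p (by have := ρ.two_le_length p hp; omega),
      (key ρ _ fun _ _ => rfl).symm⟩

/-- The data of the simple representation over the vertex `i`: it is `k` at `i` and zero at the
other vertices, and all arrows act as zero. -/
noncomputable def simplePreRep (k : Type u) [Field k] {V : Type u} [Quiver.{u} V] [DecidableEq V]
    (i : V) : PreRep k (fun _ : V => k) where
  obj j := (if j = i then ⊤ else ⊥ : Submodule k k)
  map _ := 0

theorem simplePreRep_pathMap [DecidableEq V] {B : V → Set k} (i : V) {j l : V}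
    {p : Quiver.Path j l} {x : APath (fun _ : V => k) j l}
    (h : IsInsertion B p x) : (simplePreRep k i).pathMap x = 0 := by
  cases h with
  | single β => exact LinearMap.ext fun m => map_zero ((simplePreRep k i).act l 1)
  | cons p x γ β => exact LinearMap.ext fun m => map_zero ((simplePreRep k i).act l 1)

/-- The simple `kΓ/I`-module `Sᵢ` over the vertex `i`, as a representation. -/
noncomputable def simpleRep [DecidableEq V] (I : Set (QuiverRelation k V)) (i : V) :
    Rep (A := fun _ : V => k) (unitResidues k V) I where
  toPreRep := simplePreRep k i
  map_relation ρ _ c hc := Finset.sum_eq_zero fun p hp => by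
    simp only [simplePreRep_pathMap i (hc p hp), smul_zero]

/-- For every vertex `i` at which some relation in `I` starts, and every successor `j` of `i` (the
end of a path of positive length that starts at `i`), `pd Sᵢ ≥ pd Sⱼ + 1` over `kΓ/I`. -/
def SimplePdCondition [DecidableEq V] [Fintype V] (I : Set (QuiverRelation k V)) : Prop :=
  ∀ i : V, (∃ ρ ∈ I, ρ.source = i) →
    ∀ (j : V) (p : Quiver.Path i j), 0 < p.length →
      rightPd (BoundPathAlgebra I) (simpleRep I j).total + 1
        ≤ rightPd (BoundPathAlgebra I) (simpleRep I i).total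

end Simple

end GBP

/-! The quiver is acyclic, so a representation is filtered by its restrictions to successor-closed
sets of vertices, and the factors are modules concentrated at one vertex (`Rep.pdLT_sub`,
`Rep.pdLT_total`). It is therefore enough to bound the projective dimension of an `A i`-module `N`
placed at the vertex `i` by the maximum of `pd N` and `pd Sᵢ` (`pdLT_conc`).

Let `X` be the `Λ`-module induced from `N`. Induction is exact and preserves projectives, so `pd X ≤
pd N` (`Induced.pdLT`). As `i` is not its own successor, the component of `X` at `i` is `N`, and the
kernel `K` of the projection from `X` to `N` is the part of `X` on the successors of `i`. By the
sequence `0 → K → X → N → 0` it remains to bound `pd K` strictly below the target bound plus one,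
shifted by one. If some relation starts at `i`, the component `X_l` at each successor `l` is
projective over `A l` (`Induced.projective_comp`). Induction along successors then bounds `X_l`,
placed at `l`, by `pd S_l`, which is at most `pd Sᵢ - 1` by hypothesis, and the filtration of `K`
gives the bound for `K`. If no relation starts at `i`, then `K` itself is projective
(`Induced.projective_sub`). This suffices when an arrow leaves `i`, because then `Sᵢ` is not
projective (`not_pdLT_simple_one`); at a sink `K` is zero.

The facts about `X` come from its universal property, applied to glued representations: `N` at `i`,
a representation `Y` on the successors of `i`, and `k`-linear maps from `N` to `Y` for the arrows
leaving `i` (`glue`). The relations starting at `i` hold in the glued object if there are none, or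
if all these maps have the form `Y_β ∘ r` for one `k`-linear `r`. Suitable choices yield the left
exactness of induction (`Induced.map_injective`) and sections of covers of `X`
(`Induced.exists_section`). Maps that are merely `k`-linear suffice, and these split because `k` is
a field: in a relator algebra elements are inserted only between arrows, never before the first or
after the last. -/

namespace GBP

set_option linter.unusedSectionVars false

/-! ### Projective dimension and short exact sequences -/

section HomologicalAlgebra

variable {R : Type u} [Ring R] {M₁ M₂ M₃ : Type u} [AddCommGroup M₁] [AddCommGroup M₂]
  [AddCommGroup M₃] [Module R M₁] [Module R M₂] [Module R M₃]

/-- The module `M` has projective dimension `< n`. -/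
abbrev PdLT (R : Type u) [Ring R] (M : Type u) [AddCommGroup M] [Module R M] (n : ℕ) : Prop :=
  HasProjectiveDimensionLT (ModuleCat.of R M) n

theorem PdLT.mono {n m : ℕ} (h : PdLT R M₁ n) (hnm : n ≤ m) : PdLT R M₁ m :=
  hasProjectiveDimensionLT_of_ge _ n _ hnm

theorem PdLT.of_equiv {n : ℕ} (e : M₁ ≃ₗ[R] M₂) (h : PdLT R M₁ n) : PdLT R M₂ n :=
  hasProjectiveDimensionLT_of_iso e.toModuleIso n

theorem pdLT_zero_iff : PdLT R M₁ 0 ↔ Subsingleton M₁ := by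
  rw [PdLT, hasProjectiveDimensionLT_zero_iff_isZero, ModuleCat.isZero_iff_subsingleton]

theorem PdLT.of_subsingleton [Subsingleton M₁] (n : ℕ) : PdLT R M₁ n :=
  (pdLT_zero_iff.2 inferInstance).mono (Nat.zero_le n)

theorem pdLT_one_iff : PdLT R M₁ 1 ↔ Module.Projective R M₁ := by
  rw [PdLT, ← projective_iff_hasProjectiveDimensionLT_one, ← IsProjective.iff_projective]

theorem shortExact_of {f : M₁ →ₗ[R] M₂} {g : M₂ →ₗ[R] M₃} (hf : Function.Injective f)
    (hg : Function.Surjective g) (h : Function.Exact f g) :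
    (ShortComplex.mk (ModuleCat.ofHom f) (ModuleCat.ofHom g)
      (by ext x; exact h.apply_apply_eq_zero x)).ShortExact :=
  ModuleCat.shortComplex_shortExact _ h hf hg

theorem PdLT.middle {f : M₁ →ₗ[R] M₂} {g : M₂ →ₗ[R] M₃} (hf : Function.Injective f)
    (hg : Function.Surjective g) (h : Function.Exact f g) {n : ℕ} (h₁ : PdLT R M₁ n)
    (h₃ : PdLT R M₃ n) : PdLT R M₂ n :=
  (shortExact_of hf hg h).hasProjectiveDimensionLT_X₂ n h₁ h₃

theorem PdLT.right {f : M₁ →ₗ[R] M₂} {g : M₂ →ₗ[R] M₃} (hf : Function.Injective f)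
    (hg : Function.Surjective g) (h : Function.Exact f g) {n : ℕ} (h₁ : PdLT R M₁ n)
    (h₂ : PdLT R M₂ (n + 1)) : PdLT R M₃ (n + 1) :=
  (shortExact_of hf hg h).hasProjectiveDimensionLT_X₃ n h₁ h₂

theorem PdLT.left {f : M₁ →ₗ[R] M₂} {g : M₂ →ₗ[R] M₃} (hf : Function.Injective f)
    (hg : Function.Surjective g) (h : Function.Exact f g) {n : ℕ} (h₂ : PdLT R M₂ n)
    (h₃ : PdLT R M₃ (n + 1)) : PdLT R M₁ n :=
  (shortExact_of hf hg h).hasProjectiveDimensionLT_X₁ n h₂ h₃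

theorem rightPd_lt_iff {S : Type u} [Ring S] {M : Type u} [AddCommGroup M] [Module Sᵐᵒᵖ M]
    {n : ℕ} : rightPd S M < n ↔ PdLT Sᵐᵒᵖ M n :=
  projectiveDimension_lt_iff

/-- Testing against finite strict bounds is enough: `b = ⊤` is trivial, `b = ⊥` is tested at `0`,
and a finite `b` at `b + 1`. This lets the whole proof work with `PdLT`. -/
theorem le_of_forall_lt_natCast {a b : WithBot ℕ∞} (h : ∀ n : ℕ, b < n → a < n) : a ≤ b := by
  induction b with
  | bot =>
    have := h 0 (by exact_mod_cast WithBot.bot_lt_coe (0 : ℕ∞))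
    rw [Nat.cast_zero, WithBot.lt_zero_iff_eq_bot] at this
    exact this.le
  | coe b =>
    induction b with
    | top => exact le_top
    | coe b =>
      have := h (b + 1) (by
        rw [Nat.cast_add, Nat.cast_one, ENat.WithBot.lt_add_one_iff]; exact le_rfl)
      rw [Nat.cast_add, Nat.cast_one, ENat.WithBot.lt_add_one_iff] at this
      exact this

end HomologicalAlgebra

/-! ### The successor relation of an acyclic quiver -/

section Order

variable {V : Type u} [Quiver.{u} V]

/-- `l` is a successor of `i`: there is a path of positive length from `i` to `l`. -/
def Succ (i l : V) : Prop := ∃ p : Quiver.Path i l, 0 < p.length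

theorem Succ.of_hom {i l : V} (β : i ⟶ l) : Succ i l :=
  ⟨Quiver.Path.nil.cons β, by simp⟩

theorem Succ.trans {i j l : V} (h : Succ i j) (h' : Succ j l) : Succ i l := by
  obtain ⟨p, hp⟩ := h
  obtain ⟨q, hq⟩ := h'
  exact ⟨p.comp q, by rw [Quiver.Path.length_comp]; omega⟩

theorem Succ.irrefl (hacyclic : ∀ (i : V) (p : Quiver.Path i i), p.length = 0) (i : V) :
    ¬ Succ i i := fun ⟨p, hp⟩ => hp.ne' (hacyclic i p)

theorem wellFounded_succ [Finite V]
    (hacyclic : ∀ (i : V) (p : Quiver.Path i i), p.length = 0) :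
    WellFounded fun l i : V => Succ i l :=
  haveI : IsTrans V fun l i : V => Succ i l := ⟨fun _ _ _ h h' => h'.trans h⟩
  haveI : Std.Irrefl fun l i : V => Succ i l := ⟨Succ.irrefl hacyclic⟩
  Finite.wellFounded_of_trans_of_irrefl _

theorem wellFounded_pred [Finite V]
    (hacyclic : ∀ (i : V) (p : Quiver.Path i i), p.length = 0) :
    WellFounded fun l i : V => Succ l i :=
  haveI : IsTrans V fun l i : V => Succ l i := ⟨fun _ _ _ h h' => h.trans h'⟩
  haveI : Std.Irrefl fun l i : V => Succ l i := ⟨Succ.irrefl hacyclic⟩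
  Finite.wellFounded_of_trans_of_irrefl _

end Order

/-! ### Ring generators of the generalized bound path algebra -/

section Generators

variable {k : Type u} [Field k] {V : Type u} [Quiver.{u} V]
  {A : V → Type u} [∀ i, Ring (A i)] [∀ i, Algebra k (A i)]
  [DecidableEq V] [Fintype V] (B : ∀ i, Set (A i)) (I : Set (QuiverRelation k V))

/-- The class of an `𝒜`-path in `k(Γ, 𝒜, I)`. -/
noncomputable def word {i j : V} (p : APath A i j) : GBPA B I :=
  (((p.cls k).toGPA : GPA k A) : GBPA B I)

/-- An element of the algebra at `l`, as an element of `k(Γ, 𝒜, I)`. -/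
noncomputable def vtx (l : V) (a : A l) : GBPA B I := word B I (APath.of a)

/-- An arrow as an element of `k(Γ, 𝒜, I)`. -/
noncomputable def arr {i j : V} (β : i ⟶ j) : GBPA B I := word B I ((APath.of 1).cons β 1)

/-- The component from `i` to `j` as an additive map. -/
def GPA.entryHom (i j : V) : GPA k A →+ PathSpace k A i j where
  toFun x := x.entry i j
  map_zero' := rfl
  map_add' _ _ := rfl

theorem PathSpace.toGPA_mul {i j l : V} (x : PathSpace k A i j) (y : PathSpace k A j l) :
    x.toGPA * y.toGPA = (PathSpace.comp x y).toGPA := by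
  refine GPA.ext fun i' l' => ?_
  rw [GPA.mul_entry, Finset.sum_eq_single j]
  · by_cases hi : i' = i
    · subst hi
      by_cases hl : l' = l
      · subst hl
        simp only [PathSpace.toGPA_entry]
      · rw [PathSpace.toGPA_entry_of_ne y (.inr hl), PathSpace.toGPA_entry_of_ne _ (.inr hl),
          map_zero]
    · rw [PathSpace.toGPA_entry_of_ne x (.inl hi), PathSpace.toGPA_entry_of_ne _ (.inl hi),
        map_zero, LinearMap.zero_apply]
  · intro j' _ hj
    rw [PathSpace.toGPA_entry_of_ne x (.inr hj), map_zero, LinearMap.zero_apply]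
  · simp

theorem PathSpace.toGPA_mul_of_ne {i j j' l : V} (x : PathSpace k A i j)
    (y : PathSpace k A j' l) (h : j ≠ j') : x.toGPA * y.toGPA = 0 := by
  refine GPA.ext fun i' l' => ?_
  rw [GPA.mul_entry, GPA.zero_entry]
  refine Finset.sum_eq_zero fun m _ => ?_
  by_cases hm : m = j
  · rw [PathSpace.toGPA_entry_of_ne y (.inl (hm ▸ h)), map_zero]
  · rw [PathSpace.toGPA_entry_of_ne x (.inr hm), map_zero, LinearMap.zero_apply]

theorem word_mul {i j l : V} (p : APath A i j) (q : APath A j l) :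
    word B I p * word B I q = word B I (p.comp q) := by
  rw [word, word, word, ← PathSpace.comp_cls, ← PathSpace.toGPA_mul]
  rfl

theorem word_mul_of_ne {i j j' l : V} (p : APath A i j) (q : APath A j' l) (h : j ≠ j') :
    word B I p * word B I q = 0 := by
  have := PathSpace.toGPA_mul_of_ne (p.cls k) (q.cls k) h
  exact congrArg (fun x : GPA k A => (x : GBPA B I)) this

theorem word_cons {i j l : V} (p : APath A i j) (β : j ⟶ l) (a : A l) :
    word B I (p.cons β a) = word B I p * arr B I β * vtx B I l a := by
  rw [arr, vtx, word_mul, word_mul]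
  have h : (p.comp ((APath.of 1).cons β 1)).comp (APath.of a) = (p.rmul 1).cons β (1 * a) := rfl
  rw [h, APath.rmul_one, one_mul]

/-- The map `PathSpace → k(Γ, 𝒜, I)`. -/
noncomputable def pathSpaceHom (i j : V) : PathSpace k A i j →+ GBPA B I where
  toFun x := (x.toGPA : GPA k A)
  map_zero' := by
    have : (0 : PathSpace k A i j).toGPA = 0 := by simp [PathSpace.toGPA]; rfl
    rw [this]; rfl
  map_add' x y := by
    have : (x + y).toGPA = x.toGPA + y.toGPA := GPA.ext fun i' j' => by
      rw [GPA.add_entry]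
      by_cases h : i' ≠ i ∨ j' ≠ j
      · simp only [PathSpace.toGPA_entry_of_ne _ h, add_zero]
      · push Not at h
        obtain ⟨rfl, rfl⟩ := h
        simp only [PathSpace.toGPA_entry]
    rw [this]; rfl

/-- Multilinearity moves a scalar into the last coefficient, so scalars are already products with
elements of the vertex algebras. Hence `gbpa_induction` needs no case for scalars. -/
theorem pathSpaceHom_smul {i j : V} (c : k) (x : PathSpace k A i j) :
    pathSpaceHom B I i j (c • x) = pathSpaceHom B I i j x * vtx B I j (c • 1) := by
  have h : PathSpace.comp x ((APath.of (c • (1 : A j))).cls k) = c • x := by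
    have := APath.cls_smul (k := k) (APath.of (1 : A j)) c 1 (APath.of (1 : A j))
    simp only [APath.one_comp, APath.comp_one] at this
    rw [this, map_smul, PathSpace.comp_one]
  have h2 := PathSpace.toGPA_mul x ((APath.of (c • (1 : A j))).cls k)
  rw [h] at h2
  exact congrArg (fun x : GPA k A => (x : GBPA B I)) h2.symm

/-- The algebra `k(Γ, 𝒜, I)` is generated as a ring by the algebras `A i` and the arrows. -/
theorem gbpa_induction {P : GBPA B I → Prop} (zero : P 0) (add : ∀ x y, P x → P y → P (x + y))
    (mul : ∀ x y, P x → P y → P (x * y)) (vtx : ∀ l a, P (vtx B I l a))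
    (arr : ∀ (i j : V) (β : i ⟶ j), P (arr B I β)) (x : GBPA B I) : P x := by
  have hw : ∀ {i j : V} (p : APath A i j), P (word B I p) := by
    intro i j p
    induction p with
    | of a => exact vtx _ a
    | cons p β a ih =>
      rw [word_cons]
      exact mul _ _ (mul _ _ ih (arr _ _ β)) (vtx _ a)
  have hp : ∀ {i j : V} (x : PathSpace k A i j), P (pathSpaceHom B I i j x) := by
    intro i j x
    induction x using PathSpace.induction with
    | cls p => exact hw p
    | zero => rw [map_zero]; exact zero
    | add x y hx hy => rw [map_add]; exact add _ _ hx hy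
    | smul c x hx => rw [pathSpaceHom_smul]; exact mul _ _ hx (vtx _ _)
  obtain ⟨x, rfl⟩ := (TwoSidedIdeal.span (relators B I)).ringCon.mk'_surjective x
  -- An element is the sum of its finitely many entries, each of which is covered by `hp`.
  have hx : x = ∑ i, ∑ j, (x.entry i j).toGPA := by
    refine GPA.ext fun i j => ?_
    change GPA.entryHom i j x = GPA.entryHom i j (∑ i, ∑ j, (x.entry i j).toGPA)
    rw [map_sum, Finset.sum_eq_single i, map_sum, Finset.sum_eq_single j]
    · exact (PathSpace.toGPA_entry _).symm
    · intro j' _ hj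
      exact PathSpace.toGPA_entry_of_ne _ (.inr hj.symm)
    · simp
    · intro i' _ hi
      rw [map_sum]
      exact Finset.sum_eq_zero fun j' _ => PathSpace.toGPA_entry_of_ne _ (.inl hi.symm)
    · simp
  have sum : ∀ {ι : Type u} (s : Finset ι) (f : ι → GBPA B I), (∀ i, P (f i)) →
      P (∑ i ∈ s, f i) := by
    intro ι s f hf
    classical
    induction s using Finset.induction_on with
    | empty => simpa using zero
    | insert a s ha ih => rw [Finset.sum_insert ha]; exact add _ _ (hf _) ih
  rw [hx, map_sum]
  refine sum _ _ fun i => ?_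
  rw [map_sum]
  exact sum _ _ fun j => hp (x.entry i j)

theorem one_eq_sum_vtx : (1 : GBPA B I) = ∑ l, vtx B I l 1 := by
  have h : (1 : GPA k A) = ∑ l, ((APath.of (1 : A l)).cls k).toGPA := by
    refine GPA.ext fun i j => ?_
    change GPA.entryHom i j 1 =
      GPA.entryHom i j (∑ l, ((APath.of (1 : A l)).cls k).toGPA)
    rw [map_sum, Finset.sum_eq_single i]
    · by_cases hj : j = i
      · subst hj
        exact (GPA.one_entry j).trans (PathSpace.toGPA_entry _).symm
      · exact (GPA.one_entry_of_ne hj).trans (PathSpace.toGPA_entry_of_ne _ (.inr hj)).symm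
    · intro l _ hl
      exact PathSpace.toGPA_entry_of_ne _ (.inl hl.symm)
    · simp
  have := congrArg (TwoSidedIdeal.span (relators B I)).ringCon.mk' h
  rw [map_one, map_sum] at this
  exact this

theorem vtx_mul (l : V) (a b : A l) : vtx B I l a * vtx B I l b = vtx B I l (a * b) :=
  word_mul B I _ _

theorem vtx_add (l : V) (a b : A l) : vtx B I l (a + b) = vtx B I l a + vtx B I l b := by
  have := APath.cls_add (k := k) (APath.of (1 : A l)) a b (APath.of (1 : A l))
  simp only [APath.one_comp, APath.comp_one] at this
  exact (congrArg (pathSpaceHom B I l l) this).trans (map_add _ _ _)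

theorem vtx_zero (l : V) : vtx B I l 0 = 0 := by
  have := vtx_add B I l 0 0
  rw [add_zero] at this
  exact left_eq_add.1 this

theorem vtx_mul_of_ne {l l' : V} (h : l ≠ l') (a : A l) (b : A l') :
    vtx B I l a * vtx B I l' b = 0 := word_mul_of_ne B I _ _ h

theorem vtx_mul_arr {i j : V} (β : i ⟶ j) : vtx B I i 1 * arr B I β = arr B I β := by
  rw [vtx, arr, word_mul, APath.one_comp]

theorem arr_mul_vtx {i j : V} (β : i ⟶ j) : arr B I β * vtx B I j 1 = arr B I β := by
  rw [vtx, arr, word_mul, APath.comp_one]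

theorem vtx_mul_arr_of_ne {i j l : V} (h : l ≠ i) (a : A l) (β : i ⟶ j) :
    vtx B I l a * arr B I β = 0 := word_mul_of_ne B I _ _ h

theorem arr_mul_vtx_of_ne {i j l : V} (h : j ≠ l) (a : A l) (β : i ⟶ j) :
    arr B I β * vtx B I l a = 0 := word_mul_of_ne B I _ _ h

/-- By multilinearity a scalar passes from the coefficient before the arrow to the one after it.
This is what makes arrows act `k`-linearly on the components of a module. -/
theorem vtx_smul_mul_arr {i j : V} (c : k) (β : i ⟶ j) :
    vtx B I i (c • 1) * arr B I β = arr B I β * vtx B I j (c • 1) := by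
  rw [vtx, vtx, arr, word_mul, word_mul]
  have h1 := APath.cls_smul (k := k) (APath.of (1 : A i)) c 1 ((APath.of (1 : A i)).cons β 1)
  have h2 := APath.cls_smul (k := k) ((APath.of (1 : A i)).cons β 1) c 1 (APath.of (1 : A j))
  simp only [APath.one_comp, APath.comp_one] at h1 h2
  have := h1.trans h2.symm
  rw [word, this]
  rfl

end Generators

/-! ### Modules as representations -/

section Modules

variable {k : Type u} [Field k] {V : Type u} [Quiver.{u} V]
  {A : V → Type u} [∀ i, Ring (A i)] [∀ i, Algebra k (A i)]
  [DecidableEq V] [Fintype V] {B : ∀ i, Set (A i)} {I : Set (QuiverRelation k V)}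
  {X Y Z : Type u} [AddCommGroup X] [Module (GBPA B I)ᵐᵒᵖ X]
  [AddCommGroup Y] [Module (GBPA B I)ᵐᵒᵖ Y] [AddCommGroup Z] [Module (GBPA B I)ᵐᵒᵖ Z]

/-- An additive map is linear if it is compatible with the action of the algebras `A l` and of the
arrows. -/
noncomputable def linearOfGenerators (φ : X →+ Y)
    (hv : ∀ (l : V) (a : A l) (x : X), φ (op (vtx B I l a) • x) = op (vtx B I l a) • φ x)
    (ha : ∀ (i j : V) (β : i ⟶ j) (x : X), φ (op (arr B I β) • x) = op (arr B I β) • φ x) :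
    X →ₗ[(GBPA B I)ᵐᵒᵖ] Y where
  __ := φ
  map_smul' r x := by
    obtain ⟨r, rfl⟩ := op_surjective r
    change φ (op r • x) = op r • φ x
    induction r using gbpa_induction generalizing x with
    | zero => simp
    | add r s hr hs => rw [MulOpposite.op_add, add_smul, add_smul, map_add, hr, hs]
    | mul r s hr hs => rw [op_mul, mul_smul, mul_smul, hs, hr]
    | vtx l a => exact hv l a x
    | arr i j β => exact ha i j β x

variable (B I) in
/-- The component `Z · 1ₗ` of a right `k(Γ, 𝒜, I)`-module, as a subgroup. -/
noncomputable def compSubgroup (Z : Type u) [AddCommGroup Z] [Module (GBPA B I)ᵐᵒᵖ Z] (l : V) :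
    AddSubgroup Z where
  -- The element `1ₗ` is idempotent, so its image is its set of fixed points.
  carrier := {z | op (vtx B I l 1) • z = z}
  zero_mem' := smul_zero _
  add_mem' {a b} ha hb := by
    simp only [Set.mem_ofPred_eq] at *
    rw [smul_add, ha, hb]
  neg_mem' {a} ha := by
    simp only [Set.mem_ofPred_eq] at *
    rw [smul_neg, ha]

variable (B I) in
/-- The component `Z · 1ₗ` of a right `k(Γ, 𝒜, I)`-module. -/
noncomputable def Comp (Z : Type u) [AddCommGroup Z] [Module (GBPA B I)ᵐᵒᵖ Z] (l : V) : Type u :=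
  compSubgroup B I Z l

noncomputable instance (l : V) : AddCommGroup (Comp B I Z l) :=
  inferInstanceAs (AddCommGroup (compSubgroup B I Z l))

/-- The inclusion of a component. -/
noncomputable def Comp.val {l : V} : Comp B I Z l →+ Z := (compSubgroup B I Z l).subtype

theorem Comp.val_injective {l : V} : Function.Injective (Comp.val : Comp B I Z l →+ Z) :=
  Subtype.val_injective

theorem Comp.one_smul_val {l : V} (z : Comp B I Z l) : op (vtx B I l 1) • z.val = z.val := z.2

variable (B I) in
/-- The action of `a : A l`, with values in the component at `l`. -/
noncomputable def Comp.proj (l : V) (a : A l) : Z →+ Comp B I Z l where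
  toFun z := ⟨op (vtx B I l a) • z, by
    change op (vtx B I l 1) • op (vtx B I l a) • z = _
    rw [← mul_smul, ← op_mul, vtx_mul, mul_one]⟩
  map_zero' := Subtype.ext (smul_zero _)
  map_add' x y := Subtype.ext (smul_add _ x y)

theorem Comp.val_proj {l : V} (a : A l) (z : Z) :
    (Comp.proj B I l a z).val = op (vtx B I l a) • z := rfl

theorem Comp.proj_val {l : V} (z : Comp B I Z l) : Comp.proj B I l 1 z.val = z :=
  Subtype.ext z.2

theorem Comp.smul_val_of_ne {l l' : V} (h : l' ≠ l) (a : A l) (z : Comp B I Z l') :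
    op (vtx B I l a) • z.val = 0 := by
  rw [← z.one_smul_val, ← mul_smul, ← op_mul, vtx_mul_of_ne _ _ h, op_zero, zero_smul]

theorem Comp.arr_smul_val_of_ne {i j l : V} (h : l ≠ i) (β : i ⟶ j) (z : Comp B I Z l) :
    op (arr B I β) • z.val = 0 := by
  rw [← z.one_smul_val, ← mul_smul, ← op_mul, vtx_mul_arr_of_ne _ _ h, op_zero, zero_smul]

noncomputable instance (l : V) : Module (A l)ᵐᵒᵖ (Comp B I Z l) where
  smul a z := Comp.proj B I l a.unop z.val
  one_smul z := Comp.proj_val z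
  mul_smul a b z := Subtype.ext (by
    change op (vtx B I l (b.unop * a.unop)) • z.val
      = op (vtx B I l a.unop) • op (vtx B I l b.unop) • z.val
    rw [← mul_smul, ← op_mul, vtx_mul])
  smul_zero a := map_zero _
  smul_add a x y := by
    change Comp.proj B I l a.unop (x + y).val = _
    rw [map_add, map_add]; rfl
  add_smul a b z := Subtype.ext (by
    change op (vtx B I l (a.unop + b.unop)) • z.val
      = op (vtx B I l a.unop) • z.val + op (vtx B I l b.unop) • z.val
    rw [vtx_add, MulOpposite.op_add, add_smul])
  zero_smul z := Subtype.ext (by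
    change op (vtx B I l 0) • z.val = 0
    rw [vtx_zero, op_zero, zero_smul])

theorem Comp.val_smul {l : V} (a : A l) (z : Comp B I Z l) :
    (op a • z).val = op (vtx B I l a) • z.val := rfl

noncomputable instance (l : V) : Module k (Comp B I Z l) :=
  Module.compHom _ (algebraMap k (A l)ᵐᵒᵖ)

theorem Comp.k_smul_def {l : V} (c : k) (z : Comp B I Z l) :
    c • z = op (algebraMap k (A l) c) • z := rfl

noncomputable instance (l : V) : IsScalarTower k (A l)ᵐᵒᵖ (Comp B I Z l) where
  smul_assoc c a z := by
    rw [Comp.k_smul_def, ← mul_smul, Algebra.smul_def]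
    rfl

/-- The action of an arrow on the components. -/
noncomputable def Comp.map {i j : V} (β : i ⟶ j) : Comp B I Z i →ₗ[k] Comp B I Z j where
  toFun z := ⟨op (arr B I β) • z.val, by
    change op (vtx B I j 1) • op (arr B I β) • z.val = _
    rw [← mul_smul, ← op_mul, arr_mul_vtx]⟩
  map_add' x y := Subtype.ext (by
    change op (arr B I β) • (x + y).val = op (arr B I β) • x.val + op (arr B I β) • y.val
    rw [map_add, smul_add])
  map_smul' c x := Subtype.ext (by
    change op (arr B I β) • op (vtx B I i (algebraMap k (A i) c)) • x.val
      = op (vtx B I j (algebraMap k (A j) c)) • op (arr B I β) • x.val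
    rw [← mul_smul, ← op_mul, ← mul_smul, ← op_mul, Algebra.algebraMap_eq_smul_one,
      Algebra.algebraMap_eq_smul_one, vtx_smul_mul_arr])

theorem Comp.val_map {i j : V} (β : i ⟶ j) (z : Comp B I Z i) :
    (Comp.map β z).val = op (arr B I β) • z.val := rfl

variable (B I) in
/-- The data of the representation which corresponds to a module. -/
noncomputable def preRepOfModule (Z : Type u) [AddCommGroup Z] [Module (GBPA B I)ᵐᵒᵖ Z] : PreRep k A where
  obj l := Comp B I Z l
  map β := Comp.map β

theorem preRepOfModule_pathMap {i j : V} (p : APath A i j) (z : Comp B I Z i) :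
    Comp.val ((preRepOfModule B I Z).pathMap p z : Comp B I Z j) = op (word B I p) • z.val := by
  induction p with
  | of a => rfl
  | cons p β a ih =>
    rw [word_cons, op_mul, op_mul, mul_smul, mul_smul, ← ih]
    rfl

variable (B I) in
/-- The representation which corresponds to a module. -/
noncomputable def repOfModule (Z : Type u) [AddCommGroup Z] [Module (GBPA B I)ᵐᵒᵖ Z] : Rep B I where
  toPreRep := preRepOfModule B I Z
  map_relation ρ hρ c hc := by
    refine LinearMap.ext fun z => Comp.val_injective (B := B) (I := I) (Z := Z) ?_
    -- The relator is zero in the quotient algebra; applying this to an element of the component at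
    -- the source is exactly the required relation.
    have h0 : (pathSpaceHom B I ρ.source ρ.target)
        (ρ.coeff.sum fun p r => r • (c p).cls k) = 0 := by
      have : (ρ.coeff.sum fun p r => r • (c p).cls k).toGPA
          ∈ TwoSidedIdeal.span (relators B I) :=
        TwoSidedIdeal.subset_span ⟨ρ, hρ, c, hc, rfl⟩
      exact (RingCon.eq _).2 this
    rw [map_finsuppSum] at h0
    have h1 := congrArg (fun r => op r • Comp.val (B := B) (I := I) (Z := Z) z) h0
    simp only [op_zero, zero_smul] at h1
    refine Eq.trans ?_ h1
    rw [Finsupp.sum, LinearMap.sum_apply]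
    refine (map_sum (Comp.val (B := B) (I := I) (Z := Z) (l := ρ.target)) _ _).trans ?_
    rw [Finsupp.sum, Finset.op_sum, Finset.sum_smul]
    refine Finset.sum_congr rfl fun p _ => ?_
    rw [pathSpaceHom_smul, op_mul, mul_smul]
    refine Eq.trans ?_ (congrArg _ (preRepOfModule_pathMap (c p) z))
    rw [← Algebra.algebraMap_eq_smul_one]
    rfl

namespace Rep

variable (M : Rep B I)

theorem op_word_smul {i j : V} (p : APath A i j) (m : M.total) :
    (op (word B I p) • m) j = M.pathMap p (m i) := by
  refine (M.op_mk_smul _ m j).trans ?_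
  rw [Finset.sum_eq_single i, PathSpace.toGPA_entry, PreRep.toHom_cls]
  · intro l _ hl
    rw [PathSpace.toGPA_entry_of_ne _ (.inl hl), map_zero, LinearMap.zero_apply]
  · simp

theorem op_word_smul_of_ne {i j l : V} (h : l ≠ j) (p : APath A i j) (m : M.total) :
    (op (word B I p) • m) l = 0 := by
  refine (M.op_mk_smul _ m l).trans (Finset.sum_eq_zero fun i' _ => ?_)
  rw [PathSpace.toGPA_entry_of_ne _ (.inr h), map_zero, LinearMap.zero_apply]

theorem op_vtx_smul (l : V) (a : A l) (m : M.total) :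
    (op (vtx B I l a) • m) l = op a • m l := M.op_word_smul _ m

theorem op_vtx_smul_of_ne {l l' : V} (h : l' ≠ l) (a : A l) (m : M.total) :
    (op (vtx B I l a) • m) l' = 0 := M.op_word_smul_of_ne h _ m

theorem op_arr_smul {i j : V} (β : i ⟶ j) (m : M.total) :
    (op (arr B I β) • m) j = M.map β (m i) := by
  refine (M.op_word_smul _ m).trans ?_
  change op (1 : A j) • M.map β (op (1 : A i) • m i) = _
  rw [op_one, op_one, one_smul, one_smul]

theorem op_arr_smul_of_ne {i j l : V} (h : l ≠ j) (β : i ⟶ j) (m : M.total) :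
    (op (arr B I β) • m) l = 0 := M.op_word_smul_of_ne h _ m

/-- The inclusion of the component at a vertex. -/
noncomputable def single (l : V) : M.obj l →+ M.total := AddMonoidHom.single M.obj l

theorem single_self (l : V) (m : M.obj l) : M.single l m l = m := Pi.single_eq_same _ _

theorem single_of_ne {l l' : V} (h : l' ≠ l) (m : M.obj l) : M.single l m l' = 0 :=
  Pi.single_eq_of_ne h _

/-- The evaluation at a vertex. -/
noncomputable def eval (l : V) : M.total →+ M.obj l := Pi.evalAddMonoidHom M.obj l

theorem total_ext {M : Rep B I} {m n : M.total} (h : ∀ l, m l = n l) : m = n := funext h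

theorem op_vtx_smul_eq (l : V) (a : A l) (m : M.total) :
    op (vtx B I l a) • m = M.single l (op a • m l) := by
  refine total_ext fun l' => ?_
  by_cases h : l' = l
  · subst h; rw [op_vtx_smul, single_self]
  · rw [op_vtx_smul_of_ne _ h, single_of_ne _ h]

theorem op_arr_smul_eq {i j : V} (β : i ⟶ j) (m : M.total) :
    op (arr B I β) • m = M.single j (M.map β (m i)) := by
  refine total_ext fun l' => ?_
  by_cases h : l' = j
  · subst h; rw [op_arr_smul, single_self]
  · rw [op_arr_smul_of_ne _ h, single_of_ne _ h]

/-- A morphism of representations as a linear map. -/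
noncomputable def totalMap {M N : Rep B I} (f : ∀ l, M.obj l →ₗ[(A l)ᵐᵒᵖ] N.obj l)
    (hf : ∀ (i j : V) (β : i ⟶ j) (m : M.obj i), f j (M.map β m) = N.map β (f i m)) :
    M.total →ₗ[(GBPA B I)ᵐᵒᵖ] N.total :=
  linearOfGenerators
    { toFun := fun m l => f l (m l)
      map_zero' := total_ext fun l => map_zero (f l)
      map_add' := fun m n => total_ext fun l => map_add (f l) (m l) (n l) }
    (fun l a m => total_ext fun l' => by
      change f l' ((op (vtx B I l a) • m) l') = _
      by_cases h : l' = l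
      · subst h; rw [op_vtx_smul, op_vtx_smul, map_smul]; rfl
      · rw [op_vtx_smul_of_ne _ h, op_vtx_smul_of_ne _ h, map_zero])
    (fun i j β m => total_ext fun l' => by
      change f l' ((op (arr B I β) • m) l') = _
      by_cases h : l' = j
      · subst h; rw [op_arr_smul, op_arr_smul, hf]; rfl
      · rw [op_arr_smul_of_ne _ h, op_arr_smul_of_ne _ h, map_zero])

end Rep

variable (B I Z) in
/-- A module is the direct sum of its components. -/
noncomputable def totalEquiv : Z ≃ₗ[(GBPA B I)ᵐᵒᵖ] (repOfModule B I Z).total :=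
  LinearEquiv.ofBijective
    (linearOfGenerators
      { toFun := fun z l => Comp.proj B I l 1 z
        map_zero' := Rep.total_ext fun l => map_zero (Comp.proj B I l 1)
        map_add' := fun x y => Rep.total_ext fun l => map_add (Comp.proj B I l 1) x y }
      (fun l a z => Rep.total_ext fun l' => by
        apply Comp.val_injective (B := B) (I := I) (Z := Z)
        change op (vtx B I l' 1) • op (vtx B I l a) • z = _
        by_cases h : l' = l
        · subst h
          rw [Rep.op_vtx_smul]
          change _ = op (vtx B I l' a) • op (vtx B I l' 1) • z
          rw [← mul_smul, ← op_mul, ← mul_smul, ← op_mul, vtx_mul, vtx_mul, one_mul, mul_one]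
        · rw [Rep.op_vtx_smul_of_ne _ h, ← mul_smul, ← op_mul, vtx_mul_of_ne _ _ (Ne.symm h),
            op_zero, zero_smul]
          rfl)
      (fun i j β z => Rep.total_ext fun l' => by
        apply Comp.val_injective (B := B) (I := I) (Z := Z)
        change op (vtx B I l' 1) • op (arr B I β) • z = _
        by_cases h : l' = j
        · subst h
          rw [Rep.op_arr_smul]
          change _ = op (arr B I β) • op (vtx B I i 1) • z
          rw [← mul_smul, ← op_mul, ← mul_smul, ← op_mul, vtx_mul_arr, arr_mul_vtx]
        · rw [Rep.op_arr_smul_of_ne _ h, ← mul_smul, ← op_mul, arr_mul_vtx_of_ne _ _ (Ne.symm h),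
            op_zero, zero_smul]
          rfl))
    (by
      constructor
      · rw [injective_iff_map_eq_zero]
        intro z hz
        rw [← one_smul (GBPA B I)ᵐᵒᵖ z, ← op_one, one_eq_sum_vtx, Finset.op_sum, Finset.sum_smul]
        refine Finset.sum_eq_zero fun l _ => ?_
        exact congrArg (Comp.val (B := B) (I := I) (Z := Z)) (congrFun hz l)
      · intro m
        refine ⟨∑ l, Comp.val (B := B) (I := I) (Z := Z) (m l), Rep.total_ext fun l => ?_⟩
        change Comp.proj B I l 1 (∑ l, Comp.val (B := B) (I := I) (Z := Z) (m l)) = m l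
        rw [map_sum, Finset.sum_eq_single l]
        · exact Comp.proj_val _
        · intro l' _ h
          exact Comp.val_injective (Comp.smul_val_of_ne h 1 _)
        · simp)

/-- A linear map on the components. -/
noncomputable def Comp.mapHom (f : Y →ₗ[(GBPA B I)ᵐᵒᵖ] Z) (l : V) :
    Comp B I Y l →ₗ[(A l)ᵐᵒᵖ] Comp B I Z l where
  toFun y := ⟨f y.val, by
    change op (vtx B I l 1) • f y.val = f y.val
    rw [← map_smul, y.one_smul_val]⟩
  map_add' x y := Subtype.ext (by
    change f (x + y).val = f x.val + f y.val
    rw [map_add, map_add])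
  map_smul' a x := Subtype.ext (map_smul f _ _)

theorem Comp.val_mapHom (f : Y →ₗ[(GBPA B I)ᵐᵒᵖ] Z) {l : V} (y : Comp B I Y l) :
    (Comp.mapHom f l y).val = f y.val := rfl

end Modules

/-! ### Concentrated and glued representations -/

section Constructions

variable {k : Type u} [Field k] {V : Type u} [Quiver.{u} V]
  {A : V → Type u} [∀ i, Ring (A i)] [∀ i, Algebra k (A i)]

theorem IsInsertion.succ {B : ∀ i, Set (A i)} {i j : V} {p : Quiver.Path i j} {x : APath A i j}
    (h : IsInsertion B p x) : Succ i j :=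
  ⟨p, by cases h <;> simp⟩

theorem PreRep.pathMap_single (M : PreRep k A) {i j : V} (β : i ⟶ j) :
    M.pathMap ((APath.of 1).cons β 1) = M.map β :=
  LinearMap.ext fun m => by
    change op (1 : A j) • M.map β (op (1 : A i) • m) = _
    rw [op_one, op_one, one_smul, one_smul]

theorem PreRep.pathMap_rmul_cons (M : PreRep k A) {i j l : V} (x : APath A i j) (γ : A j)
    (β : j ⟶ l) (m : M.obj i) :
    M.pathMap ((x.rmul γ).cons β 1) m = M.map β (op γ • M.pathMap x m) := by
  change op (1 : A l) • M.map β (M.pathMap (x.rmul γ) m) = _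
  rw [op_one, one_smul, PreRep.pathMap_rmul]
  rfl

/-- The module at the vertex `i`, concentrated at `i`. -/
noncomputable def concPreRep (N : PreRep k A) (i : V) : PreRep k A where
  -- Functions on the proposition `l = i`: the module `N.obj l` if it holds and zero otherwise, with
  -- no transport along the equality.
  obj l := PLift (l = i) → N.obj l
  map _ := 0

theorem concPreRep_pathMap {B : ∀ i, Set (A i)} (N : PreRep k A) (i : V) {j l : V}
    {p : Quiver.Path j l} {x : APath A j l} (h : IsInsertion B p x) :
    (concPreRep N i).pathMap x = 0 := by
  cases h with
  | single β => exact LinearMap.ext fun m => map_zero ((concPreRep N i).act l 1)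
  | cons p x γ β => exact LinearMap.ext fun m => map_zero ((concPreRep N i).act l 1)

/-- The module at the vertex `i`, as a representation concentrated at `i`. -/
noncomputable def conc (B : ∀ i, Set (A i)) (I : Set (QuiverRelation k V)) (N : PreRep k A)
    (i : V) : Rep B I where
  toPreRep := concPreRep N i
  map_relation ρ _ c hc := Finset.sum_eq_zero fun p hp => by
    simp only [concPreRep_pathMap N i (hc p hp), smul_zero]

open Classical in
/-- The data with the module `N i` at `i`, the modules `Y l` at the successors `l` of `i`, the
arrows of `Y` between these, and the maps `θ` for the arrows which start at `i`. -/
noncomputable def gluePreRep (N Y : PreRep k A) (i : V)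
    (θ : ∀ {l l' : V}, (l ⟶ l') → (N.obj l →ₗ[k] Y.obj l')) : PreRep k A where
  obj l := (PLift (l = i) → N.obj l) × (PLift (Succ i l) → Y.obj l)
  map {l l'} β :=
    { toFun := fun t => (0, fun _ => (if h : l = i then θ β (t.1 ⟨h⟩) else 0)
        + (if h : Succ i l then Y.map β (t.2 ⟨h⟩) else 0))
      map_add' := fun s t => Prod.ext (by simp) (funext fun _ => by
        simp only [Prod.fst_add, Prod.snd_add, Pi.add_apply]
        split_ifs <;> simp [add_add_add_comm])
      map_smul' := fun c t => Prod.ext (by simp) (funext fun _ => by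
        simp only [Prod.smul_fst, Prod.smul_snd, Pi.smul_apply, RingHom.id_apply]
        split_ifs <;> simp) }

section Glue

variable {N Y : PreRep k A} {i : V}
  {θ : ∀ {l l' : V}, (l ⟶ l') → (N.obj l →ₗ[k] Y.obj l')}

-- Since `i` is not its own successor, at most one of the two summands is present at each vertex,
-- and only the `Y`-part of the map survives here.
open Classical in
theorem gluePreRep_map_of_succ (hi : ¬ Succ i i) {l l' : V} (hl : Succ i l) (β : l ⟶ l')
    (t : (gluePreRep N Y i θ).obj l) :
    (gluePreRep N Y i θ).map β t = (0, fun _ => Y.map β (t.2 ⟨hl⟩)) := by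
  refine Prod.ext rfl (funext fun _ => ?_)
  change dite _ _ _ + dite _ _ _ = _
  rw [dif_neg (fun h : l = i => hi (by subst h; exact hl)), dif_pos hl, zero_add]

open Classical in
theorem gluePreRep_map_of_eq (hi : ¬ Succ i i) {l l' : V} (hl : l = i) (β : l ⟶ l')
    (t : (gluePreRep N Y i θ).obj l) :
    (gluePreRep N Y i θ).map β t = (0, fun _ => θ β (t.1 ⟨hl⟩)) := by
  subst hl
  refine Prod.ext rfl (funext fun _ => ?_)
  change dite _ _ _ + dite _ _ _ = _
  rw [dif_pos rfl, dif_neg hi, add_zero]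

/-- After its first arrow the path runs through successors of `i` only, where the glued arrows are
those of `Y`. So it suffices that the arrows leaving `l₀` act on `t` as they do in `Y` on one
element `u`. -/
theorem gluePreRep_pathMap {B : ∀ i, Set (A i)} (hi : ¬ Succ i i) {l₀ l : V}
    (h₀ : l₀ = i ∨ Succ i l₀)
    (t : (gluePreRep N Y i θ).obj l₀) (u : Y.obj l₀)
    (hu : ∀ (l : V) (β : l₀ ⟶ l), (gluePreRep N Y i θ).map β t = (0, fun _ => Y.map β u))
    {p : Quiver.Path l₀ l} {x : APath A l₀ l} (h : IsInsertion B p x) :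
    (gluePreRep N Y i θ).pathMap x t = (0, fun _ => Y.pathMap x u) := by
  induction h with
  | single β => rw [PreRep.pathMap_single, hu, PreRep.pathMap_single]
  | @cons j l p x γ β hx hγ ih =>
    have hj : Succ i j := by
      rcases h₀ with rfl | h₀
      · exact hx.succ
      · exact h₀.trans hx.succ
    rw [PreRep.pathMap_rmul_cons, gluePreRep_map_of_succ hi hj, ih, PreRep.pathMap_rmul_cons]
    rfl

end Glue

/-- The representation with the module `N i` at `i`, the modules `Y l` at the successors `l` of
`i`, and the maps `θ` for the arrows which start at `i`. -/
noncomputable def glue {B : ∀ i, Set (A i)} {I : Set (QuiverRelation k V)} (N : PreRep k A)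
    (Y : Rep B I) (i : V) (hi : ¬ Succ i i)
    (θ : ∀ {l l' : V}, (l ⟶ l') → (N.obj l →ₗ[k] Y.obj l'))
    (hθ : (∀ ρ ∈ I, ρ.source ≠ i) ∨ ∃ r : ∀ l, N.obj l →ₗ[k] Y.obj l,
      ∀ (l l' : V) (β : l ⟶ l'), θ β = Y.map β ∘ₗ r l) : Rep B I where
  toPreRep := gluePreRep N Y.toPreRep i θ
  map_relation ρ hρ c hc := by
    refine LinearMap.ext fun t => ?_
    -- All paths of a relation share their start, so one `u` serves them all and the relation at `t`
    -- is inherited from `Y` at `u`.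
    have key : ∀ u : Y.obj ρ.source, (ρ.source = i ∨ Succ i ρ.source) →
        (∀ (l : V) (β : ρ.source ⟶ l),
          (gluePreRep N Y.toPreRep i θ).map β t = (0, fun _ => Y.map β u)) →
        (ρ.coeff.sum fun p r => r • (gluePreRep N Y.toPreRep i θ).pathMap (c p)) t = 0 := by
      intro u h₀ hu
      have h1 := LinearMap.congr_fun (Y.map_relation ρ hρ c hc) u
      rw [Finsupp.sum, LinearMap.sum_apply] at h1 ⊢
      let E : Y.obj ρ.target →ₗ[k] (gluePreRep N Y.toPreRep i θ).obj ρ.target :=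
        LinearMap.inr k (PLift (ρ.target = i) → N.obj ρ.target)
          (PLift (Succ i ρ.target) → Y.obj ρ.target) ∘ₗ LinearMap.pi fun _ => LinearMap.id
      refine Eq.trans (Finset.sum_congr rfl fun p hp => ?_)
        ((map_sum E _ _).symm.trans ((congrArg E h1).trans (map_zero E)))
      rw [LinearMap.smul_apply, gluePreRep_pathMap hi h₀ t u hu (hc p hp), LinearMap.smul_apply,
        map_smul]
      rfl
    by_cases h : ρ.source = i
    · rcases hθ with hθ | ⟨r, hr⟩
      · exact absurd h (hθ ρ hρ)
      -- The common factor `r` supplies the element of `Y` that imitates `t`.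
      · refine key (r _ (t.1 ⟨h⟩)) (.inl h) fun l β => ?_
        rw [gluePreRep_map_of_eq hi h, hr]
        rfl
    · by_cases h' : Succ i ρ.source
      · exact key (t.2 ⟨h'⟩) (.inr h') fun l β => gluePreRep_map_of_succ hi h' β t
      · have ht : t = 0 := Prod.ext (funext fun x => absurd x.down h)
          (funext fun x => absurd x.down h')
        rw [ht, map_zero, map_zero]

variable [DecidableEq V] [Fintype V] (B : ∀ i, Set (A i)) (I : Set (QuiverRelation k V))

/-! ### Induced modules and their universal property -/

/-- The defining relations of the module induced from the module `N i` at the vertex `i`. -/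
inductive IsInducedRel (N : PreRep k A) (i : V) :
    ((Σ l, N.obj l) →₀ (GBPA B I)ᵐᵒᵖ) → Prop
  | add (l : V) (m n : N.obj l) : IsInducedRel N i
      (Finsupp.single ⟨l, m + n⟩ 1 - Finsupp.single ⟨l, m⟩ 1 - Finsupp.single ⟨l, n⟩ 1)
  | smul (l : V) (a : A l) (n : N.obj l) : IsInducedRel N i
      (Finsupp.single ⟨l, op a • n⟩ 1 - Finsupp.single ⟨l, n⟩ (op (vtx B I l a)))
  -- Generators are taken at all vertices, again to avoid transport along `l = i`; those away from
  -- `i` are killed.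
  | off (l : V) (hl : l ≠ i) (n : N.obj l) : IsInducedRel N i (Finsupp.single ⟨l, n⟩ 1)

/-- The right `k(Γ, 𝒜, I)`-module induced from the `A i`-module `N i`. -/
abbrev Induced (N : PreRep k A) (i : V) : Type u :=
  ((Σ l, N.obj l) →₀ (GBPA B I)ᵐᵒᵖ) ⧸
    Submodule.span (GBPA B I)ᵐᵒᵖ {x | IsInducedRel B I N i x}

namespace Induced

variable {B I} {N : PreRep k A} {i : V} {Z : Type u} [AddCommGroup Z] [Module (GBPA B I)ᵐᵒᵖ Z]

variable (B I N i) in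
/-- The generators of the induced module (zero at the vertices other than `i`). -/
noncomputable def gen (l : V) : N.obj l →+ Induced B I N i :=
  AddMonoidHom.mk' (fun n => Submodule.Quotient.mk (Finsupp.single ⟨l, n⟩ 1)) fun m n => by
    rw [← sub_eq_zero, ← sub_sub]
    exact (Submodule.Quotient.mk_eq_zero _).2 (Submodule.subset_span (.add l m n))

theorem gen_smul (l : V) (a : A l) (n : N.obj l) :
    gen B I N i l (op a • n) = op (vtx B I l a) • gen B I N i l n := by
  rw [← sub_eq_zero]
  have := (Submodule.Quotient.mk_eq_zero
      (Submodule.span (GBPA B I)ᵐᵒᵖ {x | IsInducedRel B I N i x})).2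
    (Submodule.subset_span (IsInducedRel.smul (B := B) (I := I) (i := i) l a n))
  refine Eq.trans ?_ this
  change _ = gen B I N i l (op a • n) - Submodule.Quotient.mk _
  congr 1
  change Submodule.Quotient.mk (op (vtx B I l a) • Finsupp.single _ _) = _
  rw [Finsupp.smul_single, smul_eq_mul, mul_one]

theorem gen_of_ne {l : V} (hl : l ≠ i) (n : N.obj l) : gen B I N i l n = 0 :=
  (Submodule.Quotient.mk_eq_zero _).2 (Submodule.subset_span (.off l hl n))

theorem induction {P : Induced B I N i → Prop} (zero : P 0)
    (add : ∀ x y, P x → P y → P (x + y)) (smul : ∀ (r : (GBPA B I)ᵐᵒᵖ) x, P x → P (r • x))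
    (gen : ∀ n, P (gen B I N i i n)) (x : Induced B I N i) : P x := by
  obtain ⟨x, rfl⟩ := Submodule.Quotient.mk_surjective _ x
  induction x using Finsupp.induction_linear with
  | zero => exact zero
  | add x y hx hy => exact add _ _ hx hy
  | single g r =>
    obtain ⟨l, n⟩ := g
    have h : P (Induced.gen B I N i l n) := by
      by_cases hl : l = i
      · subst hl; exact gen n
      · rw [gen_of_ne hl]; exact zero
    have := smul r _ h
    have h2 : r • Induced.gen B I N i l n
        = Submodule.Quotient.mk (Finsupp.single (⟨l, n⟩ : Σ l, N.obj l) r) := by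
      change Submodule.Quotient.mk (r • Finsupp.single _ _) = _
      rw [Finsupp.smul_single, smul_eq_mul, mul_one]
    rwa [h2] at this

theorem hom_ext {f g : Induced B I N i →ₗ[(GBPA B I)ᵐᵒᵖ] Z}
    (h : ∀ n, f (gen B I N i i n) = g (gen B I N i i n)) : f = g := by
  refine LinearMap.ext fun x => ?_
  induction x using Induced.induction with
  | zero => simp
  | add x y hx hy => simp [hx, hy]
  | smul r x hx => rw [map_smul, map_smul, hx]
  | gen n => exact h n

/-- The universal property of the induced module. -/
noncomputable def lift (g : ∀ l, N.obj l →+ Z)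
    (hg : ∀ (l : V) (a : A l) (n : N.obj l), g l (op a • n) = op (vtx B I l a) • g l n)
    (h₀ : ∀ l, l ≠ i → ∀ n, g l n = 0) : Induced B I N i →ₗ[(GBPA B I)ᵐᵒᵖ] Z :=
  Submodule.liftQ _ (Finsupp.linearCombination _ fun x : Σ l, N.obj l => g x.1 x.2) (by
    rw [Submodule.span_le]
    rintro x (⟨l, m, n⟩ | ⟨l, a, n⟩ | ⟨l, hl, n⟩)
    · simp
    · simp [hg]
    · simp [h₀ l hl])

theorem lift_gen (g : ∀ l, N.obj l →+ Z) (hg) (h₀) (l : V) (n : N.obj l) :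
    lift (B := B) (I := I) (i := i) g hg h₀ (gen B I N i l n) = g l n := by
  refine (Submodule.liftQ_apply _ _ _).trans ?_
  simp

/-- A family of homomorphisms to the components of a representation which vanish away from `i`
induces a homomorphism from the induced module. -/
noncomputable def liftTotal {M : Rep B I} (g : ∀ l, N.obj l →ₗ[(A l)ᵐᵒᵖ] M.obj l)
    (h₀ : ∀ l, l ≠ i → ∀ n, g l n = 0) : Induced B I N i →ₗ[(GBPA B I)ᵐᵒᵖ] M.total :=
  lift (fun l => (M.single l).comp (g l).toAddMonoidHom)
    (fun l a n => by
      rw [M.op_vtx_smul_eq]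
      refine congrArg (M.single l) ?_
      refine (map_smul (g l) _ _).trans ?_
      rw [← M.single_self l (g l n)]
      rfl)
    (fun l hl n => by
      refine (congrArg (M.single l) (h₀ l hl n)).trans (map_zero _))

theorem liftTotal_gen {M : Rep B I} (g : ∀ l, N.obj l →ₗ[(A l)ᵐᵒᵖ] M.obj l) (h₀) (l : V)
    (n : N.obj l) : liftTotal (i := i) g h₀ (gen B I N i l n) = M.single l (g l n) :=
  lift_gen _ _ _ _ _

end Induced

end Constructions

/-! ### The component of the induced module at its vertex -/

section Structure

variable {k : Type u} [Field k] {V : Type u} [Quiver.{u} V]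
  {A : V → Type u} [∀ i, Ring (A i)] [∀ i, Algebra k (A i)]
  [DecidableEq V] [Fintype V] {B : ∀ i, Set (A i)} {I : Set (QuiverRelation k V)}

namespace Induced

variable {N : PreRep k A} {i : V}

theorem vtx_smul_gen (n : N.obj i) : op (vtx B I i 1) • gen B I N i i n = gen B I N i i n := by
  rw [← gen_smul, op_one, one_smul]

/-- The induced module is concentrated at `i` and its successors, and its component at `i` consists
of the generators. -/
theorem vtx_smul_cases (hi : ¬ Succ i i) (x : Induced B I N i) :
    (∀ l, l ≠ i → ¬ Succ i l → op (vtx B I l 1) • x = 0) ∧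
      ∃ n, op (vtx B I i 1) • x = gen B I N i i n := by
  induction x using Induced.induction with
  | zero => exact ⟨fun _ _ _ => smul_zero _, 0, by rw [smul_zero, map_zero]⟩
  | add x y hx hy =>
    obtain ⟨hx, m, hm⟩ := hx
    obtain ⟨hy, n, hn⟩ := hy
    exact ⟨fun l h h' => by rw [smul_add, hx l h h', hy l h h', add_zero],
      m + n, by rw [smul_add, hm, hn, map_add]⟩
  | gen n =>
    refine ⟨fun l h _ => ?_, n, vtx_smul_gen n⟩
    rw [← vtx_smul_gen, ← mul_smul, ← op_mul, vtx_mul_of_ne _ _ (Ne.symm h), op_zero, zero_smul]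
  | smul r x hx =>
    obtain ⟨r, rfl⟩ := op_surjective r
    induction r using gbpa_induction generalizing x with
    | zero => exact ⟨fun _ _ _ => by simp, 0, by simp⟩
    | add r s hr hs =>
      obtain ⟨hr, m, hm⟩ := hr x hx
      obtain ⟨hs, n, hn⟩ := hs x hx
      rw [MulOpposite.op_add, add_smul]
      exact ⟨fun l h h' => by rw [smul_add, hr l h h', hs l h h', add_zero],
        m + n, by rw [smul_add, hm, hn, map_add]⟩
    | mul r s hr hs =>
      rw [op_mul, mul_smul]
      exact hs _ (hr _ hx)
    | vtx l₀ a =>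
      obtain ⟨hx, n, hn⟩ := hx
      have h1 : ∀ l, l ≠ l₀ → op (vtx B I l 1) • op (vtx B I l₀ a) • x = 0 := fun l h => by
        rw [← mul_smul, ← op_mul, vtx_mul_of_ne _ _ (Ne.symm h), op_zero, zero_smul]
      have h2 : op (vtx B I l₀ 1) • op (vtx B I l₀ a) • x
          = op (vtx B I l₀ a) • op (vtx B I l₀ 1) • x := by
        rw [← mul_smul, ← mul_smul, ← op_mul, ← op_mul, vtx_mul, vtx_mul, one_mul, mul_one]
      refine ⟨fun l h h' => ?_, ?_⟩
      · by_cases hl : l = l₀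
        · subst hl; rw [h2, hx l h h', smul_zero]
        · exact h1 l hl
      · by_cases hl : i = l₀
        · subst hl; exact ⟨op a • n, by rw [h2, hn, gen_smul]⟩
        · exact ⟨0, by rw [h1 i hl, map_zero]⟩
    | arr i₀ j₀ β =>
      obtain ⟨hx, n, hn⟩ := hx
      have h1 : ∀ l, l ≠ j₀ → op (vtx B I l 1) • op (arr B I β) • x = 0 := fun l h => by
        rw [← mul_smul, ← op_mul, arr_mul_vtx_of_ne _ _ (Ne.symm h), op_zero, zero_smul]
      -- The arrow sees only the component at its source `i₀`. If `j₀` is not a successor of `i`,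
      -- then `i₀` is neither `i` nor a successor of `i`, and that component vanishes by induction.
      have h2 : ¬ Succ i j₀ → op (vtx B I j₀ 1) • op (arr B I β) • x = 0 := fun h => by
        rw [← mul_smul, ← op_mul, arr_mul_vtx, ← vtx_mul_arr, op_mul, mul_smul,
          hx i₀ (fun h' => h (by subst h'; exact Succ.of_hom β))
            (fun h' => h (h'.trans (Succ.of_hom β))), smul_zero]
      refine ⟨fun l h h' => ?_, 0, ?_⟩
      · by_cases hl : l = j₀
        · subst hl; exact h2 h'
        · exact h1 l hl
      · rw [map_zero]
        by_cases hl : i = j₀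
        · subst hl; exact h2 hi
        · exact h1 i hl

variable (B I N i) in
/-- The map from the module at `l` to the component at `l` of the module concentrated at `i`. -/
noncomputable def toConcComp (l : V) : N.obj l →ₗ[(A l)ᵐᵒᵖ] (conc B I N i).obj l :=
  (LinearMap.pi fun _ => LinearMap.id : N.obj l →ₗ[(A l)ᵐᵒᵖ] (PLift (l = i) → N.obj l))

variable (B I N i) in
/-- The projection from the induced module to the module concentrated at `i`. -/
noncomputable def toConc : Induced B I N i →ₗ[(GBPA B I)ᵐᵒᵖ] (conc B I N i).total :=
  liftTotal (toConcComp B I N i) fun _ hl _ => funext fun h => absurd h.down hl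

theorem toConc_gen (n : N.obj i) : toConc B I N i (gen B I N i i n) i ⟨rfl⟩ = n := by
  have h := (congrFun (liftTotal_gen (toConcComp B I N i)
    (fun _ hl _ => funext fun h => absurd h.down hl) i n) i).trans (Rep.single_self _ _ _)
  exact congrFun h ⟨rfl⟩

theorem toConc_vtx_smul (x : Induced B I N i) :
    toConc B I N i (op (vtx B I i 1) • x) i = toConc B I N i x i := by
  rw [map_smul, Rep.op_vtx_smul, op_one, one_smul]

/-- The component at `i` consists of generators, and `toConc` recovers a generator from its image.
Thus this component is `N` itself. -/
theorem gen_toConc (hi : ¬ Succ i i) (x : Induced B I N i) :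
    gen B I N i i (toConc B I N i x i ⟨rfl⟩) = op (vtx B I i 1) • x := by
  obtain ⟨n, hn⟩ := (vtx_smul_cases hi x).2
  rw [← toConc_vtx_smul, hn, toConc_gen]

theorem conc_ext {x y : (conc B I N i).total} (h : x i ⟨rfl⟩ = y i ⟨rfl⟩) : x = y :=
  funext fun l => funext fun ⟨hl⟩ => by subst hl; exact h

theorem toConc_surjective : Function.Surjective (toConc B I N i) := fun t =>
  ⟨gen B I N i i (t i ⟨rfl⟩), conc_ext (toConc_gen _)⟩

variable (B I N i) in
/-- The generators as elements of the components. -/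
noncomputable def genComp (l : V) : N.obj l →ₗ[(A l)ᵐᵒᵖ] Comp B I (Induced B I N i) l where
  toFun n := Comp.proj B I l 1 (gen B I N i l n)
  map_add' x y := by rw [map_add, map_add]
  map_smul' a n := Comp.val_injective (by
    obtain ⟨a, rfl⟩ := op_surjective a
    rw [RingHom.id_apply, Comp.val_smul, Comp.val_proj, Comp.val_proj, gen_smul, ← mul_smul,
      ← mul_smul, ← op_mul, ← op_mul, vtx_mul, vtx_mul, mul_one, one_mul])

theorem val_genComp (n : N.obj i) :
    (genComp B I N i i n).val = gen B I N i i n := vtx_smul_gen n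

end Induced

/-! ### Filtration by successor-closed sets of vertices -/

/-- The submodule of a representation on a set of vertices which is closed under successors. -/
noncomputable def Rep.sub (M : Rep B I) (U : V → Prop)
    (hU : ∀ (i j : V), (i ⟶ j) → U i → U j) :
    Submodule (GBPA B I)ᵐᵒᵖ M.total where
  carrier := {m | ∀ l, ¬ U l → m l = 0}
  zero_mem' _ _ := rfl
  add_mem' {a b} ha hb l hl := by
    change a l + b l = 0
    rw [ha l hl, hb l hl, add_zero]
  smul_mem' r m hm := by
    obtain ⟨r, rfl⟩ := op_surjective r
    induction r using gbpa_induction generalizing m with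
    | zero => rw [op_zero, zero_smul]; exact fun _ _ => rfl
    | add r s hr hs =>
      intro l hl
      rw [MulOpposite.op_add, add_smul]
      change (op r • m) l + (op s • m) l = 0
      rw [hr m hm l hl, hs m hm l hl, add_zero]
    | mul r s hr hs =>
      rw [op_mul, mul_smul]
      exact hs _ (hr _ hm)
    | vtx l₀ a =>
      intro l hl
      by_cases h : l = l₀
      · subst h; rw [M.op_vtx_smul, hm l hl, smul_zero]
      · exact M.op_vtx_smul_of_ne h a m
    | arr i₀ j₀ β =>
      intro l hl
      by_cases h : l = j₀
      · subst h; rw [M.op_arr_smul, hm _ fun h => hl (hU _ _ β h), map_zero]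
      · exact M.op_arr_smul_of_ne h β m

/-- The projection to the component at a source of `U`. -/
noncomputable def Rep.subToConc (M : Rep B I) (U : V → Prop)
    (hU : ∀ (i j : V), (i ⟶ j) → U i → U j) (i : V) (hi : ∀ l, (l ⟶ i) → ¬ U l) :
    M.sub U hU →ₗ[(GBPA B I)ᵐᵒᵖ] (conc B I M.toPreRep i).total :=
  linearOfGenerators
    { toFun := fun m l _ => m.1 l
      map_zero' := rfl
      map_add' := fun _ _ => rfl }
    (fun l a m => Induced.conc_ext (by
      change (op (vtx B I l a) • m.1) i = _
      by_cases h : i = l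
      · subst h; rw [M.op_vtx_smul, Rep.op_vtx_smul]; rfl
      · rw [M.op_vtx_smul_of_ne h, Rep.op_vtx_smul_of_ne _ h]; rfl))
    (fun j l β m => Induced.conc_ext (by
      change (op (arr B I β) • m.1) i = _
      by_cases h : i = l
      · subst h
        rw [M.op_arr_smul, m.2 j (hi j β), map_zero, Rep.op_arr_smul]; rfl
      · rw [M.op_arr_smul_of_ne h, Rep.op_arr_smul_of_ne _ h]; rfl))

theorem Rep.pdLT_sub (hacyclic : ∀ (i : V) (p : Quiver.Path i i), p.length = 0) (M : Rep B I)
    {m : ℕ} (n : ℕ) (U : V → Prop) (hU : ∀ (i j : V), (i ⟶ j) → U i → U j)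
    (hn : Nat.card {l // U l} = n)
    (h : ∀ l, U l → PdLT (GBPA B I)ᵐᵒᵖ (conc B I M.toPreRep l).total m) :
    PdLT (GBPA B I)ᵐᵒᵖ (M.sub U hU) m := by
  induction n generalizing U with
  | zero =>
    have hU' : ∀ l, ¬ U l := fun l hl => by
      rw [Nat.card_eq_zero] at hn
      rcases hn with hn | hn
      · exact hn.false ⟨l, hl⟩
      · exact not_finite {l // U l}
    have : Subsingleton (M.sub U hU) :=
      ⟨fun x y => Subtype.ext (Rep.total_ext fun l => by rw [x.2 l (hU' l), y.2 l (hU' l)])⟩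
    exact .of_subsingleton m
  | succ n ih =>
    have hne : {l | U l}.Nonempty := by
      have : Nonempty {l // U l} := (Nat.card_pos_iff.1 (by omega)).1
      obtain ⟨l, hl⟩ := this
      exact ⟨l, hl⟩
    -- A vertex of `U` without predecessors in `U`: removing it leaves a closed set, and evaluation
    -- at it is a homomorphism whose kernel is the smaller submodule.
    obtain ⟨i, hi, hmin⟩ := (wellFounded_pred hacyclic).has_min _ hne
    have hi' : ∀ l, (l ⟶ i) → ¬ U l := fun l β hl => hmin l hl (Succ.of_hom β)
    let U' : V → Prop := fun l => U l ∧ l ≠ i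
    have hU' : ∀ (a b : V), (a ⟶ b) → U' a → U' b := fun a b β ha =>
      ⟨hU a b β ha.1, fun hb => by subst hb; exact hi' a β ha.1⟩
    have hle : M.sub U' hU' ≤ M.sub U hU := fun x hx l hl => hx l fun h => hl h.1
    have hcard : Nat.card {l // U' l} = n := by
      have h1 : {l | U' l} = {l | U l} \ {i} := rfl
      have h2 : Nat.card {l // U' l} = ({l | U l} \ {i}).ncard := by rw [← h1]; rfl
      have h3 : {l | U l}.ncard = n + 1 := hn
      rw [h2, Set.ncard_sdiff_singleton_of_mem (show i ∈ {l | U l} from hi), h3]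
      omega
    refine PdLT.middle (f := Submodule.inclusion hle) (g := M.subToConc U hU i hi')
      (Submodule.inclusion_injective hle) ?_ ?_ (ih U' hU' hcard fun l hl => h l hl.1) (h i hi)
    · intro t
      refine ⟨⟨M.single i (t i ⟨rfl⟩), fun l hl => M.single_of_ne ?_ _⟩,
        Induced.conc_ext (M.single_self i _)⟩
      rintro rfl
      exact hl hi
    · intro x
      constructor
      · intro hx
        have hx : x.1 i = 0 := congrFun (congrFun hx i) ⟨rfl⟩
        refine ⟨⟨x.1, fun l hl => ?_⟩, rfl⟩
        by_cases hli : l = i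
        · subst hli; exact hx
        · exact x.2 l fun h' => hl ⟨h', hli⟩
      · rintro ⟨y, rfl⟩
        exact Induced.conc_ext (y.2 i fun h => h.2 rfl)

/-- The projective dimension of a representation is bounded by those of its components. -/
theorem Rep.pdLT_total (hacyclic : ∀ (i : V) (p : Quiver.Path i i), p.length = 0) (M : Rep B I)
    {m : ℕ} (h : ∀ l, PdLT (GBPA B I)ᵐᵒᵖ (conc B I M.toPreRep l).total m) :
    PdLT (GBPA B I)ᵐᵒᵖ M.total m := by
  have h1 := M.pdLT_sub hacyclic _ (fun _ => True) (fun _ _ _ _ => trivial) rfl fun l _ => h l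
  have h2 : M.sub (fun _ => True) (fun _ _ _ _ => trivial) = ⊤ :=
    eq_top_iff.2 fun x _ l hl => absurd trivial hl
  rw [h2] at h1
  exact h1.of_equiv Submodule.topEquiv

end Structure

/-! ### Sections over the successors, obtained by gluing -/

section Lifting

variable {k : Type u} [Field k] {V : Type u} [Quiver.{u} V]
  {A : V → Type u} [∀ i, Ring (A i)] [∀ i, Algebra k (A i)]

section Glue

variable {B : ∀ i, Set (A i)} {I : Set (QuiverRelation k V)} {N : PreRep k A}
  {Y : Rep B I} {i : V} {hi : ¬ Succ i i}
  {θ : ∀ {l l' : V}, (l ⟶ l') → (N.obj l →ₗ[k] Y.obj l')}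
  {hθ : (∀ ρ ∈ I, ρ.source ≠ i) ∨ ∃ r : ∀ l, N.obj l →ₗ[k] Y.obj l,
    ∀ (l l' : V) (β : l ⟶ l'), θ β = Y.map β ∘ₗ r l}

variable (N Y i hi θ hθ) in
/-- The inclusion of `N i` into the glued representation. -/
noncomputable def glueInl (l : V) : N.obj l →ₗ[(A l)ᵐᵒᵖ] (glue N Y i hi θ hθ).obj l :=
  (LinearMap.inl (A l)ᵐᵒᵖ (PLift (l = i) → N.obj l) (PLift (Succ i l) → Y.obj l) ∘ₗ
    LinearMap.pi fun _ => LinearMap.id :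
      N.obj l →ₗ[(A l)ᵐᵒᵖ] (PLift (l = i) → N.obj l) × (PLift (Succ i l) → Y.obj l))

theorem glueInl_of_ne (l : V) (hl : l ≠ i) (n : N.obj l) : glueInl N Y i hi θ hθ l n = 0 :=
  Prod.ext (funext fun h => absurd h.down hl) rfl

variable (N Y i hi θ hθ) in
open Classical in
/-- A linear map out of a component of the glued representation. -/
noncomputable def glueDesc {l : V} {X : Type u} [AddCommGroup X] [Module (A l)ᵐᵒᵖ X]
    (f : N.obj l →ₗ[(A l)ᵐᵒᵖ] X) (g : Y.obj l →ₗ[(A l)ᵐᵒᵖ] X) :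
    (glue N Y i hi θ hθ).obj l →ₗ[(A l)ᵐᵒᵖ] X :=
  (LinearMap.coprod
    (if h : l = i then f ∘ₗ LinearMap.proj ⟨h⟩ else 0)
    (if h : Succ i l then g ∘ₗ LinearMap.proj ⟨h⟩ else 0) :
      (PLift (l = i) → N.obj l) × (PLift (Succ i l) → Y.obj l) →ₗ[(A l)ᵐᵒᵖ] X)

open Classical in
theorem glueDesc_of_eq {l : V} {X : Type u} [AddCommGroup X] [Module (A l)ᵐᵒᵖ X]
    (f : N.obj l →ₗ[(A l)ᵐᵒᵖ] X) (g : Y.obj l →ₗ[(A l)ᵐᵒᵖ] X) (hl : l = i)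
    (t : (glue N Y i hi θ hθ).obj l) :
    glueDesc N Y i hi θ hθ f g t = f (t.1 ⟨hl⟩) := by
  change (dite _ _ _ : _ →ₗ[(A l)ᵐᵒᵖ] X) t.1 + (dite _ _ _ : _ →ₗ[(A l)ᵐᵒᵖ] X) t.2 = _
  rw [dif_pos hl, dif_neg (by subst hl; exact hi)]
  exact add_zero _

open Classical in
theorem glueDesc_of_succ {l : V} {X : Type u} [AddCommGroup X] [Module (A l)ᵐᵒᵖ X]
    (f : N.obj l →ₗ[(A l)ᵐᵒᵖ] X) (g : Y.obj l →ₗ[(A l)ᵐᵒᵖ] X) (hl : Succ i l)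
    (t : (glue N Y i hi θ hθ).obj l) :
    glueDesc N Y i hi θ hθ f g t = g (t.2 ⟨hl⟩) := by
  change (dite _ _ _ : _ →ₗ[(A l)ᵐᵒᵖ] X) t.1 + (dite _ _ _ : _ →ₗ[(A l)ᵐᵒᵖ] X) t.2 = _
  rw [dif_neg (by rintro rfl; exact hi hl), dif_pos hl]
  exact zero_add _

end Glue

variable [DecidableEq V] [Fintype V] {B : ∀ i, Set (A i)} {I : Set (QuiverRelation k V)}

/-- Let `π : Y → X` be a morphism to the representation `X` of an induced module with `k`-linear
sections `s` at the successors of `i`. If the maps `s X_β` at `i` satisfy the relations which start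
at `i`, then there are sections which are morphisms on the successors of `i`. -/
theorem Induced.exists_section {N : PreRep k A} {i : V} (hi : ¬ Succ i i) (Y : Rep B I)
    (π : ∀ l, Y.obj l →ₗ[(A l)ᵐᵒᵖ] Comp B I (Induced B I N i) l)
    (hπ : ∀ (l l' : V) (β : l ⟶ l') (y : Y.obj l), π l' (Y.map β y) = Comp.map β (π l y))
    (s : ∀ l, Comp B I (Induced B I N i) l →ₗ[k] Y.obj l)
    (hs : ∀ l, Succ i l → ∀ x, π l (s l x) = x)
    (hθ : (∀ ρ ∈ I, ρ.source ≠ i) ∨ ∃ r : ∀ l, N.obj l →ₗ[k] Y.obj l,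
      ∀ (l l' : V) (β : l ⟶ l'),
        s l' ∘ₗ Comp.map β ∘ₗ (genComp B I N i l).restrictScalars k = Y.map β ∘ₗ r l) :
    ∃ τ : ∀ l, Comp B I (Induced B I N i) l →ₗ[(A l)ᵐᵒᵖ] Y.obj l,
      (∀ l, Succ i l → ∀ x, π l (τ l x) = x) ∧
      ∀ (l l' : V) (β : l ⟶ l'), Succ i l → ∀ x, τ l' (Comp.map β x) = Y.map β (τ l x) := by
  classical
  -- The induced module is mapped to the gluing of `N` with `Y` along the `k`-linear lifts of its
  -- own arrows at `i`.
  let θ : ∀ {l l' : V}, (l ⟶ l') → (N.obj l →ₗ[k] Y.obj l') := fun {l l'} β =>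
    s l' ∘ₗ Comp.map β ∘ₗ (genComp B I N i l).restrictScalars k
  let T : Rep B I := glue N Y i hi θ hθ
  let φ : Induced B I N i →ₗ[(GBPA B I)ᵐᵒᵖ] T.total :=
    liftTotal (glueInl N Y i hi θ hθ) glueInl_of_ne
  let X : Rep B I := repOfModule B I (Induced B I N i)
  let f : ∀ l, T.obj l →ₗ[(A l)ᵐᵒᵖ] X.obj l := fun l =>
    glueDesc N Y i hi θ hθ (genComp B I N i l) (π l)
  have hf : ∀ (l l' : V) (β : l ⟶ l') (t : T.obj l), f l' (T.map β t) = X.map β (f l t) := by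
    intro l l' β t
    by_cases h : l = i
    · have hl' : Succ i l' := by subst h; exact Succ.of_hom β
      have h1 : f l t = genComp B I N i l (t.1 ⟨h⟩) := glueDesc_of_eq _ _ h t
      have h2 : T.map β t = (0, fun _ => θ β (t.1 ⟨h⟩)) := gluePreRep_map_of_eq hi h β t
      rw [h1, h2]
      exact (glueDesc_of_succ _ _ hl' _).trans (hs l' hl' _)
    · by_cases h' : Succ i l
      · have hl' : Succ i l' := h'.trans (Succ.of_hom β)
        have h1 : f l t = π l (t.2 ⟨h'⟩) := glueDesc_of_succ _ _ h' t
        have h2 : T.map β t = (0, fun _ => Y.map β (t.2 ⟨h'⟩)) :=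
          gluePreRep_map_of_succ hi h' β t
        rw [h1, h2]
        exact (glueDesc_of_succ _ _ hl' _).trans (hπ l l' β _)
      · have ht : t = 0 := Prod.ext (funext fun x => absurd x.down h)
          (funext fun x => absurd x.down h')
        rw [ht, map_zero, map_zero, map_zero, map_zero]
  -- Both sides agree on generators, so following `φ` by the map built from `π` is the canonical
  -- isomorphism.
  have hcomp : (Rep.totalMap f hf) ∘ₗ φ = (totalEquiv B I (Induced B I N i)).toLinearMap := by
    refine Induced.hom_ext fun n => Rep.total_ext fun l => ?_
    change f l (φ (gen B I N i i n) l) = Comp.proj B I l 1 (gen B I N i i n)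
    have h1 : φ (gen B I N i i n) = T.single i (glueInl N Y i hi θ hθ i n) :=
      liftTotal_gen _ _ _ _
    rw [h1]
    by_cases h : l = i
    · subst h
      rw [Rep.single_self]
      exact glueDesc_of_eq _ _ rfl _
    · rw [Rep.single_of_ne _ h, map_zero]
      refine (Comp.val_injective ?_).symm
      rw [Comp.val_proj, ← vtx_smul_gen, ← mul_smul, ← op_mul, vtx_mul_of_ne _ _ (Ne.symm h),
        op_zero, zero_smul]
      rfl
  -- Hence the `Y`-part of `φ` splits `π`. It is linear over `A l` and compatible with arrows
  -- because `φ` is a homomorphism, although `s` was only `k`-linear.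
  have key : ∀ l (h : Succ i l) (x : Comp B I (Induced B I N i) l),
      π l ((φ x.val l).2 ⟨h⟩) = x := by
    intro l h x
    have h1 := congrFun (LinearMap.congr_fun hcomp x.val) l
    refine ((glueDesc_of_succ _ _ h (φ x.val l)).symm.trans h1).trans ?_
    exact Comp.proj_val x
  refine ⟨fun l =>
    { toFun := fun x => if h : Succ i l then (φ x.val l).2 ⟨h⟩ else 0
      map_add' := fun x y => ?_
      map_smul' := fun a x => ?_ }, fun l h x => ?_, fun l l' β h x => ?_⟩
  · split_ifs with h
    · rw [map_add, map_add]; rfl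
    · rw [add_zero]
  · split_ifs with h
    · obtain ⟨a, rfl⟩ := op_surjective a
      rw [Comp.val_smul, map_smul, Rep.op_vtx_smul]; rfl
    · rw [smul_zero]
  · change π l (dite _ _ _) = x
    rw [dif_pos h, key l h x]
  · have h' : Succ i l' := h.trans (Succ.of_hom β)
    change dite _ _ _ = Y.map β (dite _ _ _)
    rw [dif_pos h, dif_pos h', Comp.val_map, map_smul, Rep.op_arr_smul]
    have := gluePreRep_map_of_succ (N := N) (Y := Y.toPreRep) (θ := θ) hi h β (φ x.val l)
    exact congrArg (fun t : (gluePreRep N Y.toPreRep i θ).obj l' => t.2 ⟨h'⟩) this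

/-- Free modules which cover the components. -/
noncomputable def freePreRep (N : PreRep k A) : PreRep k A where
  obj l := N.obj l →₀ (A l)ᵐᵒᵖ
  map _ := 0

/-- The canonical projection from the free modules. -/
noncomputable def freeProj (N : PreRep k A) (l : V) :
    (freePreRep N).obj l →ₗ[(A l)ᵐᵒᵖ] N.obj l :=
  (Finsupp.linearCombination _ id : (N.obj l →₀ (A l)ᵐᵒᵖ) →ₗ[(A l)ᵐᵒᵖ] N.obj l)

theorem freeProj_surjective (N : PreRep k A) (l : V) : Function.Surjective (freeProj N l) :=
  Finsupp.linearCombination_id_surjective _ _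

theorem exists_linear_section {l : V} {M N : Type u} [AddCommGroup M] [AddCommGroup N]
    [Module k M] [Module k N] [Module (A l)ᵐᵒᵖ M] [Module (A l)ᵐᵒᵖ N]
    [IsScalarTower k (A l)ᵐᵒᵖ M] [IsScalarTower k (A l)ᵐᵒᵖ N] (f : M →ₗ[(A l)ᵐᵒᵖ] N)
    (hf : Function.Surjective f) : ∃ s : N →ₗ[k] M, ∀ x, f (s x) = x := by
  obtain ⟨s, hs⟩ := (f.restrictScalars k).exists_rightInverse_of_surjective
    (LinearMap.range_eq_top.2 hf)
  exact ⟨s, LinearMap.congr_fun hs⟩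

/-- The modules `F l` with the maps `s X_β π`, where `s` is a section of `π : F → X`. -/
noncomputable def twist (X : Rep B I) (F : PreRep k A)
    (π : ∀ l, F.obj l →ₗ[(A l)ᵐᵒᵖ] X.obj l) (s : ∀ l, X.obj l →ₗ[k] F.obj l)
    (hs : ∀ l x, π l (s l x) = x) : Rep B I where
  obj := F.obj
  map {l l'} β := s l' ∘ₗ X.map β ∘ₗ (π l).restrictScalars k
  map_relation ρ hρ c hc := by
    let F' : PreRep k A :=
      { F with map := fun {l l'} β => s l' ∘ₗ X.map β ∘ₗ (π l).restrictScalars k }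
    -- The composite telescopes: inserted elements pass through the `A`-linear `π`, after which `π ∘
    -- s` cancels. Only an `s` at the end and a `π` at the start remain.
    have key : ∀ {i j : V} {p : Quiver.Path i j} {x : APath A i j}, IsInsertion B p x →
        ∀ m : F'.obj i, F'.pathMap x m = s j (X.pathMap x (π i m)) := by
      intro i j p x hx m
      induction hx with
      | single β => rw [PreRep.pathMap_single, PreRep.pathMap_single]; rfl
      | @cons j l p x γ β hx hγ ih =>
        rw [PreRep.pathMap_rmul_cons, PreRep.pathMap_rmul_cons, ih]
        change s l (X.map β (π j (op γ • s j _))) = _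
        rw [map_smul, hs]
    refine LinearMap.ext fun m => ?_
    have h1 := LinearMap.congr_fun (X.map_relation ρ hρ c hc) (π _ m)
    change (ρ.coeff.sum fun p r => r • F'.pathMap (c p)) m = 0
    rw [Finsupp.sum, LinearMap.sum_apply] at h1 ⊢
    refine Eq.trans (Finset.sum_congr rfl fun p hp => ?_)
      ((map_sum (s ρ.target) _ _).symm.trans ((congrArg (s ρ.target) h1).trans (map_zero _)))
    rw [LinearMap.smul_apply, LinearMap.smul_apply, map_smul, key (hc p hp)]

/-- The components of an induced module at the successors of `i` are projective. -/
theorem Induced.projective_comp {N : PreRep k A} {i : V} (hi : ¬ Succ i i) (l : V)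
    (hl : Succ i l) : Module.Projective (A l)ᵐᵒᵖ (Comp B I (Induced B I N i) l) := by
  let X : Rep B I := repOfModule B I (Induced B I N i)
  let F : PreRep k A := freePreRep X.toPreRep
  let π : ∀ l, F.obj l →ₗ[(A l)ᵐᵒᵖ] X.obj l := freeProj X.toPreRep
  have hs : ∀ l, ∃ s : X.obj l →ₗ[k] F.obj l, ∀ x, π l (s x) = x := fun l =>
    exists_linear_section (π l) (freeProj_surjective _ l)
  choose s hs using hs
  -- With `r = s ∘ gen` the factorization at `i` holds because `π ∘ s` is the identity. The
  -- resulting `A l`-linear section makes the component a summand of a free module; compatibility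
  -- with arrows is not needed.
  obtain ⟨τ, hτ, -⟩ := Induced.exists_section (B := B) (I := I) (N := N) hi (twist X F π s hs) π
    (fun l l' β y => hs _ _) s (fun l _ x => hs l x)
    (.inr ⟨fun l => s l ∘ₗ (genComp B I N i l).restrictScalars k, fun l l' β =>
      LinearMap.ext fun n => (congrArg (fun x => s l' (X.map β x)) (hs l _)).symm⟩)
  have : Module.Projective (A l)ᵐᵒᵖ ((twist X F π s hs).obj l) :=
    inferInstanceAs (Module.Projective (A l)ᵐᵒᵖ (X.obj l →₀ (A l)ᵐᵒᵖ))
  exact Module.Projective.of_split (τ l) (π l) (LinearMap.ext fun x => hτ l hl x)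

end Lifting

/-! ### The part of the induced module on the successors -/

section InducedPd

variable {k : Type u} [Field k] {V : Type u} [Quiver.{u} V]
  {A : V → Type u} [∀ i, Ring (A i)] [∀ i, Algebra k (A i)]
  [DecidableEq V] [Fintype V] {B : ∀ i, Set (A i)} {I : Set (QuiverRelation k V)}

theorem totalEquiv_val {Z : Type u} [AddCommGroup Z] [Module (GBPA B I)ᵐᵒᵖ Z] {l : V}
    (z : Comp B I Z l) : totalEquiv B I Z z.val = (repOfModule B I Z).single l z := by
  refine Rep.total_ext fun l' => ?_
  by_cases h : l' = l
  · subst h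
    exact (Comp.proj_val z).trans ((repOfModule B I Z).single_self l' z).symm
  · exact (Comp.val_injective (Comp.smul_val_of_ne (Ne.symm h) 1 z)).trans
      ((repOfModule B I Z).single_of_ne h z).symm

theorem Rep.sum_single (M : Rep B I) (m : M.total) : ∑ l, M.single l (m l) = m :=
  Finset.univ_sum_single (M := M.obj) m

/-- If no relation starts at `i`, then the part of an induced module on the successors of `i` is
projective. -/
theorem Induced.projective_sub {N : PreRep k A} {i : V} (hi : ¬ Succ i i)
    (hI : ∀ ρ ∈ I, ρ.source ≠ i) : Module.Projective (GBPA B I)ᵐᵒᵖ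
      ((repOfModule B I (Induced B I N i)).sub (Succ i) fun _ _ β h => h.trans (.of_hom β)) := by
  classical
  let X : Rep B I := repOfModule B I (Induced B I N i)
  let K := X.sub (Succ i) fun _ _ β h => h.trans (.of_hom β)
  let E := totalEquiv B I (Induced B I N i)
  let Q := K →₀ (GBPA B I)ᵐᵒᵖ
  let p : Q →ₗ[(GBPA B I)ᵐᵒᵖ] K := Finsupp.linearCombination _ id
  have hp : Function.Surjective p := Finsupp.linearCombination_id_surjective _ _
  -- A free cover of `K`, viewed as a map to the induced module; it is onto exactly where needed, in
  -- the components at successors of `i`.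
  let q : Q →ₗ[(GBPA B I)ᵐᵒᵖ] Induced B I N i := E.symm.toLinearMap ∘ₗ K.subtype ∘ₗ p
  let Y : Rep B I := repOfModule B I Q
  let π : ∀ l, Y.obj l →ₗ[(A l)ᵐᵒᵖ] Comp B I (Induced B I N i) l := fun l => Comp.mapHom q l
  have hπ : ∀ (l l' : V) (β : l ⟶ l') (y : Y.obj l), π l' (Y.map β y) = Comp.map β (π l y) :=
    fun l l' β y => Comp.val_injective (map_smul q _ _)
  have hsurj : ∀ l, Succ i l → Function.Surjective (π l) := by
    intro l hl x
    have hx : X.single l x ∈ K := fun l' hl' => X.single_of_ne (by rintro rfl; exact hl' hl) x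
    obtain ⟨y, hy⟩ := hp ⟨_, hx⟩
    refine ⟨Comp.proj B I l 1 y, Comp.val_injective ?_⟩
    change q (op (vtx B I l 1) • y) = x.val
    rw [map_smul]
    change op (vtx B I l 1) • E.symm (p y).1 = _
    rw [hy]
    have hx' : E.symm (X.single l x) = x.val :=
      (congrArg E.symm (totalEquiv_val x).symm).trans (E.symm_apply_apply _)
    exact (congrArg _ hx').trans x.one_smul_val
  have hs : ∀ l, ∃ s : Comp B I (Induced B I N i) l →ₗ[k] Y.obj l,
      Succ i l → ∀ x, π l (s x) = x := fun l => by
    by_cases h : Succ i l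
    · obtain ⟨s, hs⟩ := exists_linear_section (k := k) (π l) (hsurj l h)
      exact ⟨s, fun _ => hs⟩
    · exact ⟨0, fun h' => absurd h' h⟩
  choose s hs using hs
  -- With no relation starting at `i`, the lifts of the arrows at `i` may be chosen freely.
  obtain ⟨τ, hτ, hτβ⟩ := Induced.exists_section hi Y π hπ s hs (.inl hI)
  let v : ∀ l, X.obj l →+ Q := fun l => Comp.val.comp (τ l).toAddMonoidHom
  let σ : K →ₗ[(GBPA B I)ᵐᵒᵖ] Q := linearOfGenerators
    (∑ l, (v l).comp ((X.eval l).comp K.subtype.toAddMonoidHom))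
    (fun l a m => by
      simp only [AddMonoidHom.finsetSum_apply]
      rw [Finset.sum_eq_single l, Finset.smul_sum, Finset.sum_eq_single l]
      · change v l ((op (vtx B I l a) • m.1) l) = op (vtx B I l a) • v l (m.1 l)
        rw [X.op_vtx_smul]
        exact congrArg Comp.val (map_smul (τ l) (op a) (m.1 l))
      · exact fun l' _ h => Comp.smul_val_of_ne h a _
      · simp
      · intro l' _ h
        change v l' ((op (vtx B I l a) • m.1) l') = 0
        rw [X.op_vtx_smul_of_ne h, map_zero]
      · simp)
    (fun i₀ j₀ β m => by
      simp only [AddMonoidHom.finsetSum_apply]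
      rw [Finset.sum_eq_single j₀, Finset.smul_sum, Finset.sum_eq_single i₀]
      · change v j₀ ((op (arr B I β) • m.1) j₀) = op (arr B I β) • v i₀ (m.1 i₀)
        rw [X.op_arr_smul]
        -- The sections respect arrows only between successors of `i`, but elements of `K` vanish at
        -- all other vertices.
        by_cases h : Succ i i₀
        · exact congrArg Comp.val (hτβ _ _ β h (m.1 i₀))
        · rw [m.2 i₀ h, map_zero, map_zero, map_zero, smul_zero]
      · exact fun l' _ h => Comp.arr_smul_val_of_ne h β _
      · simp
      · intro l' _ h
        change v l' ((op (arr B I β) • m.1) l') = 0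
        rw [X.op_arr_smul_of_ne h, map_zero]
      · simp)
  refine Module.Projective.of_split σ p (LinearMap.ext fun m => Subtype.ext ?_)
  have hσ : σ m = ∑ l, v l (m.1 l) :=
    AddMonoidHom.finsetSum_apply _ _ m
  have hE : ∀ l, (p (v l (m.1 l))).1 = X.single l (m.1 l) := fun l => by
    refine (E.apply_symm_apply _).symm.trans ?_
    by_cases h : Succ i l
    · exact (congrArg E (congrArg Comp.val (hτ l h (m.1 l)))).trans (totalEquiv_val _)
    · rw [m.2 l h, map_zero, map_zero, map_zero]
      exact (congrArg E (map_zero E.symm)).trans (map_zero E)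
  change K.subtype (p (σ m)) = m.1
  rw [hσ, map_sum, map_sum]
  exact (Finset.sum_congr rfl fun l _ => hE l).trans (X.sum_single m.1)

/-! ### Induction is exact and preserves projectives -/

namespace Induced

variable {N' P N : PreRep k A} {i : V}

/-- Induced modules are functorial. -/
noncomputable def map (f : ∀ l, P.obj l →ₗ[(A l)ᵐᵒᵖ] N.obj l) :
    Induced B I P i →ₗ[(GBPA B I)ᵐᵒᵖ] Induced B I N i :=
  lift (fun l => (gen B I N i l).comp (f l).toAddMonoidHom)
    (fun l _ _ => (congrArg (gen B I N i l) (map_smul (f l) _ _)).trans (gen_smul _ _ _))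
    (fun _ hl _ => gen_of_ne hl _)

theorem map_gen (f : ∀ l, P.obj l →ₗ[(A l)ᵐᵒᵖ] N.obj l) (l : V) (n : P.obj l) :
    map f (gen B I P i l n) = gen B I N i l (f l n) := lift_gen _ _ _ _ _

theorem map_surjective (f : ∀ l, P.obj l →ₗ[(A l)ᵐᵒᵖ] N.obj l)
    (hf : Function.Surjective (f i)) : Function.Surjective (map (B := B) (I := I) (i := i) f) := by
  intro x
  induction x using Induced.induction with
  | zero => exact ⟨0, map_zero _⟩
  | add x y hx hy =>
    obtain ⟨x, rfl⟩ := hx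
    obtain ⟨y, rfl⟩ := hy
    exact ⟨x + y, map_add _ _ _⟩
  | smul r x hx =>
    obtain ⟨x, rfl⟩ := hx
    exact ⟨r • x, map_smul _ _ _⟩
  | gen n =>
    obtain ⟨n, rfl⟩ := hf n
    exact ⟨_, map_gen _ _ _⟩

/-- Right exactness from the universal property: the map from the generators of `P` to the cokernel
`C` of `map f` factors through `N`. This gives `D` with `D ∘ map g` the quotient map, so the kernel
of `map g` lies in the range of `map f`. -/
theorem map_exact (f : ∀ l, N'.obj l →ₗ[(A l)ᵐᵒᵖ] P.obj l)
    (g : ∀ l, P.obj l →ₗ[(A l)ᵐᵒᵖ] N.obj l) (hg : ∀ l, Function.Surjective (g l))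
    (h : ∀ l, Function.Exact (f l) (g l)) :
    Function.Exact (map (B := B) (I := I) (i := i) f) (map g) := by
  have hcomp : (map g).comp (map f) = (0 : Induced B I N' i →ₗ[_] Induced B I N i) :=
    hom_ext fun n => by
      rw [LinearMap.comp_apply, map_gen, map_gen, (h i).apply_apply_eq_zero, map_zero]
      rfl
  let C := Induced B I P i ⧸ LinearMap.range (map (B := B) (I := I) (i := i) f)
  let c : ∀ l, P.obj l →+ C := fun l =>
    (LinearMap.range (map f)).mkQ.toAddMonoidHom.comp (gen B I P i l)
  have hc : ∀ l, (g l).toAddMonoidHom.ker ≤ (c l).ker := by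
    intro l n hn
    obtain ⟨m, rfl⟩ := (h l n).1 hn
    refine (Submodule.Quotient.mk_eq_zero _).2 ⟨gen B I N' i l m, map_gen _ _ _⟩
  let d : ∀ l, N.obj l →+ C := fun l =>
    (g l).toAddMonoidHom.liftOfRightInverse _ (Function.rightInverse_surjInv (hg l)) ⟨c l, hc l⟩
  have hd : ∀ l n, d l (g l n) = c l n := fun l n =>
    (g l).toAddMonoidHom.liftOfRightInverse_comp_apply _
      (Function.rightInverse_surjInv (hg l)) ⟨c l, hc l⟩ n
  let D : Induced B I N i →ₗ[(GBPA B I)ᵐᵒᵖ] C := lift d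
    (fun l a n => by
      obtain ⟨n, rfl⟩ := hg l n
      rw [← map_smul, hd, hd]
      change Submodule.mkQ _ (gen B I P i l (op a • n)) = _
      rw [gen_smul, map_smul]
      rfl)
    (fun l hl n => by
      obtain ⟨n, rfl⟩ := hg l n
      rw [hd]
      change Submodule.mkQ _ (gen B I P i l n) = _
      rw [gen_of_ne hl, map_zero])
  have hD : D.comp (map g) = (LinearMap.range (map f)).mkQ := hom_ext fun n => by
    rw [LinearMap.comp_apply, map_gen]
    exact (lift_gen _ _ _ _ _).trans (hd i n)
  intro x
  constructor
  · intro hx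
    have h1 := LinearMap.congr_fun hD x
    rw [LinearMap.comp_apply, hx, map_zero] at h1
    exact (Submodule.Quotient.mk_eq_zero _).1 h1.symm
  · rintro ⟨y, rfl⟩
    exact LinearMap.congr_fun hcomp y

theorem eq_zero_of_forall_vtx_smul {Z : Type u} [AddCommGroup Z] [Module (GBPA B I)ᵐᵒᵖ Z] {z : Z}
    (h : ∀ l, op (vtx B I l 1) • z = 0) : z = 0 :=
  (totalEquiv B I Z).map_eq_zero_iff.1 (Rep.total_ext fun l =>
    Comp.val_injective (h l))

/-- Glue `P` at `i` to the successor part of the module induced from `N'`, through a `k`-linear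
retraction `r` of `f`. The composite of `map f` with the canonical map to this representation is `f`
at `i` and the identity at the successors, hence injective. -/
theorem map_injective (hi : ¬ Succ i i) (f : ∀ l, N'.obj l →ₗ[(A l)ᵐᵒᵖ] P.obj l)
    (hf : ∀ l, Function.Injective (f l)) :
    Function.Injective (map (B := B) (I := I) (i := i) f) := by
  classical
  have hr : ∀ l, ∃ r : P.obj l →ₗ[k] N'.obj l, ∀ n, r (f l n) = n := fun l => by
    obtain ⟨r, hr⟩ := ((f l).restrictScalars k).exists_leftInverse_of_injective
      (LinearMap.ker_eq_bot.2 (hf l))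
    exact ⟨r, LinearMap.congr_fun hr⟩
  choose r hr using hr
  let Y : Rep B I := repOfModule B I (Induced B I N' i)
  let r' : ∀ l, P.obj l →ₗ[k] Y.obj l := fun l =>
    ((genComp B I N' i l).restrictScalars k).comp (r l)
  let θ : ∀ {l l' : V}, (l ⟶ l') → (P.obj l →ₗ[k] Y.obj l') := fun {l _} β => Y.map β ∘ₗ r' l
  have hθ : (∀ ρ ∈ I, ρ.source ≠ i) ∨ ∃ r : ∀ l, P.obj l →ₗ[k] Y.obj l,
      ∀ (l l' : V) (β : l ⟶ l'), θ β = Y.map β ∘ₗ r l := .inr ⟨r', fun _ _ _ => rfl⟩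
  let T : Rep B I := glue P Y i hi θ hθ
  let φ : Induced B I P i →ₗ[(GBPA B I)ᵐᵒᵖ] T.total :=
    liftTotal (glueInl P Y i hi θ hθ) glueInl_of_ne
  let t : ∀ l, Induced B I N' i →+ T.obj l := fun l =>
    { toFun := fun x => (fun h => f l (toConc B I N' i x l h), fun _ => Comp.proj B I l 1 x)
      map_zero' := by
        refine Prod.ext (funext fun h => ?_) (funext fun h => map_zero _)
        change f l (toConc B I N' i 0 l h) = 0
        rw [map_zero]
        exact map_zero _
      map_add' := fun x y => by
        refine Prod.ext (funext fun h => ?_) (funext fun h => map_add _ _ _)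
        change f l (toConc B I N' i (x + y) l h) = _
        rw [map_add]
        exact map_add _ _ _ }
  let d : Induced B I N' i →ₗ[(GBPA B I)ᵐᵒᵖ] T.total := linearOfGenerators
    { toFun := fun x l => t l x
      map_zero' := Rep.total_ext fun l => map_zero (t l)
      map_add' := fun x y => Rep.total_ext fun l => map_add (t l) x y }
    (fun l a x => Rep.total_ext fun l' => by
      change t l' (op (vtx B I l a) • x) = _
      by_cases h : l' = l
      · subst h
        rw [Rep.op_vtx_smul]
        refine Prod.ext (funext fun h => ?_) (funext fun h => Comp.val_injective ?_)
        · change f l' (toConc B I N' i (op (vtx B I l' a) • x) l' h) = op a • f l' _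
          rw [map_smul, Rep.op_vtx_smul, ← map_smul]
          rfl
        · change op (vtx B I l' 1) • op (vtx B I l' a) • x
            = op (vtx B I l' a) • op (vtx B I l' 1) • x
          rw [← mul_smul, ← mul_smul, ← op_mul, ← op_mul, vtx_mul, vtx_mul, one_mul, mul_one]
      · rw [Rep.op_vtx_smul_of_ne _ h]
        refine Prod.ext (funext fun h' => ?_) (funext fun _ => Comp.val_injective ?_)
        · change f l' (toConc B I N' i (op (vtx B I l a) • x) l' h') = 0
          rw [map_smul, Rep.op_vtx_smul_of_ne _ h]
          exact map_zero _
        · change op (vtx B I l' 1) • op (vtx B I l a) • x = 0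
          rw [← mul_smul, ← op_mul, vtx_mul_of_ne _ _ (Ne.symm h), op_zero, zero_smul])
    (fun j l β x => Rep.total_ext fun l' => by
      change t l' (op (arr B I β) • x) = _
      have h1 : ∀ h', f l' (toConc B I N' i (op (arr B I β) • x) l' h') = 0 := fun h' => by
        rw [map_smul]
        by_cases h : l' = l
        · subst h
          rw [Rep.op_arr_smul]
          exact map_zero _
        · rw [Rep.op_arr_smul_of_ne _ h]
          exact map_zero _
      by_cases h : l' = l
      · subst h
        rw [Rep.op_arr_smul]
        refine Prod.ext (funext h1) (funext fun h' => Comp.val_injective ?_)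
        have h2 : (Comp.proj B I l' 1 (op (arr B I β) • x)).val
            = op (arr B I β) • op (vtx B I j 1) • x := by
          rw [Comp.val_proj, ← mul_smul, ← mul_smul, ← op_mul, ← op_mul, arr_mul_vtx,
            vtx_mul_arr]
        refine h2.trans ?_
        by_cases hj : j = i
        · have h3 := gluePreRep_map_of_eq (N := P) (Y := Y.toPreRep) (θ := θ) hi hj β (t j x)
          refine Eq.trans ?_ (congrArg (fun t : (gluePreRep P Y.toPreRep i θ).obj l' =>
            Comp.val (t.2 h')) h3).symm
          change _ = op (arr B I β) • (genComp B I N' i j (r j (f j _))).val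
          -- Compatibility with the arrows leaving `i` is where `r ∘ f = id` enters.
          rw [hr]
          subst hj
          rw [val_genComp, gen_toConc hi]
        · by_cases hj' : Succ i j
          · have h3 := gluePreRep_map_of_succ (N := P) (Y := Y.toPreRep) (θ := θ) hi hj' β (t j x)
            exact (congrArg (fun t : (gluePreRep P Y.toPreRep i θ).obj l' =>
              Comp.val (t.2 h')) h3).symm
          · have ht : t j x = 0 := Prod.ext (funext fun x => absurd x.down hj)
              (funext fun x => absurd x.down hj')
            rw [(vtx_smul_cases hi x).1 j hj hj', smul_zero]
            change 0 = Comp.val ((T.map β (t j x)).2 h')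
            rw [ht, map_zero]
            rfl
      · rw [Rep.op_arr_smul_of_ne _ h]
        refine Prod.ext (funext h1) (funext fun _ => Comp.val_injective ?_)
        change op (vtx B I l' 1) • op (arr B I β) • x = 0
        rw [← mul_smul, ← op_mul, arr_mul_vtx_of_ne _ _ (Ne.symm h), op_zero, zero_smul])
  have hφ : φ.comp (map f) = d := hom_ext fun n => by
    rw [LinearMap.comp_apply, map_gen]
    refine (liftTotal_gen _ _ _ _).trans (Rep.total_ext fun l => ?_)
    change _ = t l (gen B I N' i i n)
    by_cases h : l = i
    · subst h
      rw [Rep.single_self]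
      refine Prod.ext (funext fun h => ?_) (funext fun h => absurd h.down hi)
      exact (congrArg (f l) (toConc_gen n)).symm
    · rw [Rep.single_of_ne _ h]
      refine Prod.ext (funext fun h' => absurd h'.down h) (funext fun h => Comp.val_injective ?_)
      change 0 = op (vtx B I l 1) • gen B I N' i i n
      rw [← vtx_smul_gen, ← mul_smul, ← op_mul, vtx_mul_of_ne _ _ (by rintro rfl; contradiction),
        op_zero, zero_smul]
  have hd : Function.Injective d := by
    rw [injective_iff_map_eq_zero]
    intro x hx
    have hx : ∀ l, t l x = 0 := fun l => congrFun hx l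
    refine eq_zero_of_forall_vtx_smul (B := B) (I := I) fun l => ?_
    by_cases h : l = i
    · subst h
      have h1 : f l (toConc B I N' l x l ⟨rfl⟩) = 0 :=
        congrFun (congrArg Prod.fst (hx l)) ⟨rfl⟩
      rw [← gen_toConc hi, (map_eq_zero_iff _ (hf l)).1 h1, map_zero]
    · by_cases h' : Succ i l
      · exact congrArg Comp.val (congrFun (congrArg Prod.snd (hx l)) ⟨h'⟩)
      · exact (vtx_smul_cases hi x).1 l h h'
  rw [← hφ] at hd
  exact Function.Injective.of_comp hd

/-- Homomorphisms from the induced module to `Z` are `A i`-homomorphisms from `N.obj i` to the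
component of `Z` at `i`, and taking components preserves surjections. So the identity lifts along a
free cover. -/
theorem projective (h : Module.Projective (A i)ᵐᵒᵖ (N.obj i)) :
    Module.Projective (GBPA B I)ᵐᵒᵖ (Induced B I N i) := by
  refine Module.Projective.of_lifting_property'' fun p hp => ?_
  let Q := Induced B I N i →₀ (GBPA B I)ᵐᵒᵖ
  have hg : ∀ l, ∃ g : N.obj l →ₗ[(A l)ᵐᵒᵖ] Comp B I Q l,
      (l = i → ∀ n, p (g n).val = gen B I N i l n) ∧ (l ≠ i → g = 0) := by
    intro l
    by_cases hl : l = i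
    · subst hl
      have hsurj : Function.Surjective (Comp.mapHom p l) := fun x => by
        obtain ⟨y, hy⟩ := hp x.val
        refine ⟨Comp.proj B I l 1 y, Comp.val_injective ?_⟩
        rw [Comp.val_mapHom, Comp.val_proj, map_smul, hy, x.one_smul_val]
      obtain ⟨g, hg⟩ := Module.projective_lifting_property (Comp.mapHom p l)
        (genComp B I N l l) hsurj
      exact ⟨g, fun _ n => by rw [← Comp.val_mapHom, ← val_genComp, ← hg]; rfl,
        fun h => absurd rfl h⟩
    · exact ⟨0, fun h => absurd h hl, fun _ => rfl⟩
  choose g hg hg₀ using hg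
  refine ⟨lift (fun l => Comp.val.comp (g l).toAddMonoidHom)
    (fun l a n => congrArg Comp.val (map_smul (g l) (op a) n))
    (fun l hl n => by simp [hg₀ l hl]), hom_ext fun n => ?_⟩
  exact (congrArg p (lift_gen _ _ _ i n)).trans (hg i rfl n)

end Induced

/-- The kernels of the free covers. -/
noncomputable def syzygy (N : PreRep k A) : PreRep k A where
  obj l := LinearMap.ker (freeProj N l)
  map _ := 0

/-- The induced module has projective dimension at most that of the module at the vertex. -/
theorem Induced.pdLT {i : V} (hi : ¬ Succ i i) (n : ℕ) (N : PreRep k A)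
    (h : PdLT (A i)ᵐᵒᵖ (N.obj i) n) : PdLT (GBPA B I)ᵐᵒᵖ (Induced B I N i) n := by
  match n with
  | 0 =>
    rw [pdLT_zero_iff] at h ⊢
    have h1 : (LinearMap.id : Induced B I N i →ₗ[(GBPA B I)ᵐᵒᵖ] _) = 0 := hom_ext fun n => by
      rw [Subsingleton.elim n 0, map_zero, map_zero, map_zero]
    exact ⟨fun x y => (LinearMap.congr_fun h1 x).trans (LinearMap.congr_fun h1 y).symm⟩
  | 1 =>
    rw [pdLT_one_iff] at h ⊢
    exact Induced.projective h
  -- Dimension shift along a free cover. The bound `n + 1` for the syzygy is at least `1`, as needed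
  -- to accommodate the free middle term.
  | n + 2 =>
    let f : ∀ l, (syzygy N).obj l →ₗ[(A l)ᵐᵒᵖ] (freePreRep N).obj l := fun l =>
      (LinearMap.ker (freeProj N l)).subtype
    have hf : ∀ l, Function.Injective (f l) := fun l => Subtype.val_injective
    have hex : ∀ l, Function.Exact (f l) (freeProj N l) := fun l =>
      LinearMap.exact_subtype_ker_map _
    have hproj : Module.Projective (A i)ᵐᵒᵖ ((freePreRep N).obj i) :=
      inferInstanceAs (Module.Projective (A i)ᵐᵒᵖ (N.obj i →₀ (A i)ᵐᵒᵖ))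
    have h1 : PdLT (A i)ᵐᵒᵖ ((syzygy N).obj i) (n + 1) :=
      .left (hf i) (freeProj_surjective N i) (hex i)
        ((pdLT_one_iff.2 hproj).mono (by omega)) h
    exact .right (map_injective hi f hf) (map_surjective _ (freeProj_surjective N i))
      (map_exact f (freeProj N) (freeProj_surjective N) hex) (Induced.pdLT hi (n + 1) _ h1)
      ((pdLT_one_iff.2 (Induced.projective hproj)).mono (by omega))

end InducedPd

/-! ### Simple modules over the bound path algebra -/

section SimpleModules

variable {k : Type u} [Field k] {V : Type u} [Quiver.{u} V] [DecidableEq V]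

/-- The data with `k` at every vertex, where the arrows which start at `i` act as the identity and
all other arrows act as zero. -/
noncomputable def outPreRep (k : Type u) [Field k] {V : Type u} [Quiver.{u} V] [DecidableEq V]
    (i : V) : PreRep k (fun _ : V => k) where
  obj _ := k
  map {l _} _ := if l = i then LinearMap.id else 0

theorem outPreRep_map_of_ne {i l l' : V} (h : l ≠ i) (β : l ⟶ l') :
    (outPreRep k i).map β = 0 := if_neg h

theorem outPreRep_map_self {i l' : V} (β : i ⟶ l') (x : (outPreRep k i).obj i) :
    (outPreRep k i).map β x = x := by
  change (if i = i then (LinearMap.id : k →ₗ[k] k) else 0) x = _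
  rw [if_pos rfl]
  rfl

theorem outPreRep_pathMap_self {B : V → Set k} {i : V} (hi : ¬ Succ i i) {j : V}
    {p : Quiver.Path j i} {x : APath (fun _ : V => k) j i} (h : IsInsertion B p x) :
    (outPreRep k i).pathMap x = 0 := by
  refine LinearMap.ext fun m => ?_
  cases h with
  | single β =>
    rw [PreRep.pathMap_single, outPreRep_map_of_ne]
    rintro rfl
    exact hi (.of_hom β)
  | cons p x γ β =>
    refine (PreRep.pathMap_rmul_cons _ _ _ _ _).trans ?_
    rw [outPreRep_map_of_ne]
    · rfl
    · rintro rfl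
      exact hi (.of_hom β)

/-- Two consecutive arrows act nontrivially only if both start at `i`, and then the first would also
end at `i`, against acyclicity. Since relations involve only paths of length at least two, they all
hold in `outRep`. -/
theorem outPreRep_pathMap {B : V → Set k} {i : V} (hi : ¬ Succ i i) {j l : V}
    {p : Quiver.Path j l} {x : APath (fun _ : V => k) j l} (h : IsInsertion B p x)
    (hp : 2 ≤ p.length) : (outPreRep k i).pathMap x = 0 := by
  refine LinearMap.ext fun m => ?_
  cases h with
  | single β => simp at hp
  | @cons j' _ p x γ β hx =>
    refine (PreRep.pathMap_rmul_cons _ _ _ _ _).trans ?_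
    by_cases h : j' = i
    · subst h
      rw [outPreRep_pathMap_self hi hx, outPreRep_map_self]
      exact smul_zero (A := k) (op γ)
    · rw [outPreRep_map_of_ne h]
      rfl

/-- The representation with `k` at every vertex, where the arrows which start at `i` act as the
identity and all other arrows act as zero. -/
noncomputable def outRep (I : Set (QuiverRelation k V)) {i : V} (hi : ¬ Succ i i) :
    Rep (A := fun _ : V => k) (unitResidues k V) I where
  toPreRep := outPreRep k i
  map_relation ρ _ c hc := Finset.sum_eq_zero fun p hp => by
    simp only [outPreRep_pathMap hi (hc p hp) (ρ.two_le_length p hp), smul_zero]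

variable (I : Set (QuiverRelation k V))

/-- The inclusion of a component of the simple representation into `k`. -/
noncomputable def simpleVal (i l : V) : (simpleRep I i).obj l →+ k :=
  (Submodule.subtype (if l = i then ⊤ else ⊥ : Submodule k k)).toAddMonoidHom

theorem simpleVal_injective (i l : V) : Function.Injective (simpleVal I i l) :=
  Subtype.val_injective

theorem subsingleton_simple {i l : V} (h : l ≠ i) : Subsingleton ((simpleRep I i).obj l) := by
  change Subsingleton (if l = i then ⊤ else ⊥ : Submodule k k)
  rw [if_neg h]
  infer_instance

noncomputable instance {i : V} (hi : ¬ Succ i i) (l : V) : Module kᵐᵒᵖ ((outRep I hi).obj l) :=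
  (outRep I hi).rightModule l

noncomputable instance (i l : V) : Module kᵐᵒᵖ ((simpleRep I i).obj l) :=
  (simpleRep I i).rightModule l

/-- The component at `i` of the projection to the simple representation. -/
noncomputable def outToSimpleSelf {i : V} (hi : ¬ Succ i i) :
    (outRep I hi).obj i →ₗ[kᵐᵒᵖ] (simpleRep I i).obj i where
  toFun m := (⟨m, by rw [if_pos rfl]; trivial⟩ : (if i = i then ⊤ else ⊥ : Submodule k k))
  map_add' _ _ := rfl
  map_smul' _ _ := rfl

/-- The projection to the simple representation. -/
noncomputable def outToSimple {i : V} (hi : ¬ Succ i i) (l : V) :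
    (outRep I hi).obj l →ₗ[kᵐᵒᵖ] (simpleRep I i).obj l :=
  if h : l = i then by subst h; exact outToSimpleSelf I hi else 0

theorem simpleVal_outToSimple {i : V} (hi : ¬ Succ i i) (m : k) :
    simpleVal I i i (outToSimple I hi i m) = m := by
  rw [outToSimple, dif_pos rfl]
  rfl

variable [Fintype V]

theorem not_pdLT_simple_zero {i : V} (hi : ¬ Succ i i) :
    ¬ PdLT (BoundPathAlgebra I)ᵐᵒᵖ (simpleRep I i).total 0 := by
  rw [pdLT_zero_iff]
  intro h
  let x := outToSimple I hi i (1 : k)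
  have h1 : x = 0 := by
    rw [← (simpleRep I i).single_self i x, Subsingleton.elim ((simpleRep I i).single i x) 0]
    rfl
  have h2 := simpleVal_outToSimple I hi 1
  change simpleVal I i i x = 1 at h2
  rw [h1, map_zero] at h2
  exact zero_ne_one h2

/-- The simple module over a vertex which is not a sink is not projective. -/
theorem not_pdLT_simple_one {i j : V} (hi : ¬ Succ i i) (α : i ⟶ j) :
    ¬ PdLT (BoundPathAlgebra I)ᵐᵒᵖ (simpleRep I i).total 1 := by
  rw [pdLT_one_iff]
  intro hproj
  let Q := outRep I hi
  let S := simpleRep I i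
  let p : Q.total →ₗ[(BoundPathAlgebra I)ᵐᵒᵖ] S.total :=
    Rep.totalMap (outToSimple I hi) fun l l' β m => by
      by_cases h : l' = i
      · have h1 : Q.map β m = 0 := by
          change (outPreRep k i).map β m = 0
          rw [outPreRep_map_of_ne]
          · rfl
          · rintro rfl
            exact hi (by subst h; exact .of_hom β)
        rw [h1, map_zero]
        rfl
      · have := subsingleton_simple I h
        exact Subsingleton.elim _ _
  have hp : Function.Surjective p := by
    intro t
    refine ⟨Q.single i (simpleVal I i i (t i)), Rep.total_ext fun l => ?_⟩
    by_cases h : l = i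
    · subst h
      apply simpleVal_injective
      exact (congrArg (fun m => simpleVal I l l (outToSimple I hi l m))
        (Q.single_self l _)).trans (simpleVal_outToSimple I hi _)
    · have := subsingleton_simple I h
      exact Subsingleton.elim _ _
  obtain ⟨s, hs⟩ := Module.projective_lifting_property p LinearMap.id hp
  -- The arrow `α` kills `x`. A section would send `x` to an element with entry `1` at `i`, which
  -- `α` does not kill.
  let x : S.total := S.single i (outToSimple I hi i (1 : k))
  have h1 : @Eq k (s x i) 1 := by
    have h2 := congrFun (LinearMap.congr_fun hs x) i
    have h3 := congrArg (simpleVal I i i) (h2.trans (S.single_self i _))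
    exact (simpleVal_outToSimple I hi (s x i)).symm.trans
      (h3.trans (simpleVal_outToSimple I hi 1))
  have h2 : op (arr (unitResidues k V) I α) • x = 0 := by
    rw [S.op_arr_smul_eq]
    exact map_zero (S.single j)
  have h3 : Q.map α (s x i) = 0 := by
    rw [← Q.op_arr_smul, ← map_smul, h2, map_zero]
    rfl
  have h4 : @Eq k (Q.map α (s x i)) (s x i) := outPreRep_map_self α _
  exact one_ne_zero (α := k) (h1.symm.trans (h4.symm.trans h3))

end SimpleModules

/-- The finite bound on `b` rules out `a = ⊤`, the one value at which adding one gains nothing and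
the conclusion fails. -/
theorem lt_of_add_one_le {a b : WithBot ℕ∞} {m : ℕ} (h : a + 1 ≤ b) (hb : b < (m + 1 : ℕ)) :
    a < m := by
  have h := h.trans_lt hb
  induction a with
  | bot => exact WithBot.bot_lt_coe _
  | coe a =>
    induction a with
    | top =>
      have h1 : ((⊤ : ℕ∞) : WithBot ℕ∞) + 1 = ⊤ := rfl
      rw [h1] at h
      exact absurd h not_top_lt
    | coe a =>
      norm_cast at h ⊢
      omega

/-! ### The bound for concentrated modules and for all representations -/

section Main

variable {k : Type u} [Field k] {V : Type u} [Quiver.{u} V]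
  {A : V → Type u} [∀ i, Ring (A i)] [∀ i, Algebra k (A i)]
  [DecidableEq V] [Fintype V] {B : ∀ i, Set (A i)} {I : Set (QuiverRelation k V)}

theorem Succ.exists_hom {i l : V} (h : Succ i l) : ∃ j, Nonempty (i ⟶ j) := by
  obtain ⟨p, hp⟩ := h
  induction p with
  | nil => simp at hp
  | cons p β ih =>
    cases p with
    | nil => exact ⟨_, ⟨β⟩⟩
    | cons p β' => exact ih (by simp)

/-- The projective dimension of a module concentrated at the vertex `i`. -/
theorem pdLT_conc (hacyclic : ∀ (i : V) (p : Quiver.Path i i), p.length = 0)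
    (hpd : SimplePdCondition I) (i : V) (N : PreRep k A) (n : ℕ)
    (hN : PdLT (A i)ᵐᵒᵖ (N.obj i) n)
    (hS : PdLT (BoundPathAlgebra I)ᵐᵒᵖ (simpleRep I i).total n) :
    PdLT (GBPA B I)ᵐᵒᵖ (conc B I N i).total n := by
  induction i using (wellFounded_succ hacyclic).induction generalizing N n with
  | _ i ih =>
  have hi : ¬ Succ i i := Succ.irrefl hacyclic i
  obtain _ | m := n
  -- The bound `0` would mean that `Sᵢ` is zero.
  · exact absurd hS (not_pdLT_simple_zero I hi)
  let X : Rep B I := repOfModule B I (Induced B I N i)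
  let E := totalEquiv B I (Induced B I N i)
  let K := X.sub (Succ i) fun _ _ β h => h.trans (.of_hom β)
  let g : X.total →ₗ[(GBPA B I)ᵐᵒᵖ] (conc B I N i).total :=
    (Induced.toConc B I N i).comp E.symm.toLinearMap
  have hg : ∀ x, g (E x) = Induced.toConc B I N i x := fun x =>
    congrArg (Induced.toConc B I N i) (E.symm_apply_apply x)
  have hexact : Function.Exact K.subtype g := by
    intro y
    obtain ⟨x, rfl⟩ := E.surjective y
    rw [hg]
    constructor
    · intro hx
      refine ⟨⟨E x, fun l hl => Comp.val_injective ?_⟩, rfl⟩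
      change op (vtx B I l 1) • x = 0
      by_cases h : l = i
      · subst h
        rw [← Induced.gen_toConc hi, hx]
        exact map_zero _
      · exact (Induced.vtx_smul_cases hi x).1 l h hl
    · rintro ⟨y, hy⟩
      have h1 : op (vtx B I i 1) • x = 0 := by
        have h2 : E x i = 0 := by rw [← hy]; exact y.2 i hi
        exact congrArg Comp.val h2
      refine Induced.conc_ext ?_
      rw [← Induced.toConc_vtx_smul, h1, map_zero]
  -- The induced module obeys the bound `m + 1`, so the kernel `K` must obey `m`.
  refine PdLT.right (f := K.subtype) (g := g) Subtype.val_injective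
    (Induced.toConc_surjective.comp E.symm.surjective) hexact ?_
    ((Induced.pdLT hi (m + 1) N hN).of_equiv E)
  by_cases h : ∃ ρ ∈ I, ρ.source = i
  · refine X.pdLT_sub hacyclic _ _ _ rfl fun l hl => ?_
    have hSl : PdLT (BoundPathAlgebra I)ᵐᵒᵖ (simpleRep I l).total m := by
      obtain ⟨p, hp⟩ := hl
      exact rightPd_lt_iff.1 (lt_of_add_one_le (hpd i h l p hp) (rightPd_lt_iff.2 hS))
    -- As `S_l` is nonzero, `m` is positive, so the projective component at `l` meets the bound `m`.
    have hm : 1 ≤ m := Nat.one_le_iff_ne_zero.2 fun h0 =>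
      not_pdLT_simple_zero I (Succ.irrefl hacyclic l) (h0 ▸ hSl)
    exact ih l hl X.toPreRep m
      ((pdLT_one_iff.2 (Induced.projective_comp hi l hl)).mono hm) hSl
  -- Here `K` is projective, which settles `m ≥ 1`. If `m = 0`, then `Sᵢ` is projective, so no arrow
  -- leaves `i` and `K` is zero.
  · obtain _ | m := m
    · have hK : Subsingleton K := by
        refine ⟨fun x y => Subtype.ext (Rep.total_ext fun l => ?_)⟩
        have hl : ¬ Succ i l := fun hl => by
          obtain ⟨j, ⟨α⟩⟩ := hl.exists_hom
          exact not_pdLT_simple_one I hi α hS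
        rw [x.2 l hl, y.2 l hl]
      exact .of_subsingleton 0
    · exact (pdLT_one_iff.2 (Induced.projective_sub hi fun ρ hρ hs => h ⟨ρ, hρ, hs⟩)).mono
        (by omega)

/-- The bound for the projective dimension of a representation, for arbitrary insertions `B`. -/
theorem rightPd_total_le (hacyclic : ∀ (i : V) (p : Quiver.Path i i), p.length = 0)
    (hpd : SimplePdCondition I) (M : Rep B I) :
    rightPd (GBPA B I) M.total ≤ ⨆ i ∈ M.supp, max (rightPd (A i) (M.obj i))
      (rightPd (BoundPathAlgebra I) (simpleRep I i).total) := by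
  refine le_of_forall_lt_natCast fun n hn => rightPd_lt_iff.2 (M.pdLT_total hacyclic fun l => ?_)
  by_cases hl : l ∈ M.supp
  · have h1 : max (rightPd (A l) (M.obj l))
        (rightPd (BoundPathAlgebra I) (simpleRep I l).total) < n :=
      (le_iSup₂ (f := fun i (_ : i ∈ M.supp) => max (rightPd (A i) (M.obj i))
        (rightPd (BoundPathAlgebra I) (simpleRep I i).total)) l hl).trans_lt hn
    rw [max_lt_iff] at h1
    exact pdLT_conc hacyclic hpd l M.toPreRep n (rightPd_lt_iff.1 h1.1) (rightPd_lt_iff.1 h1.2)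
  -- A vertex outside the support contributes a zero factor, which satisfies every bound, including
  -- `0`.
  · have : Subsingleton (M.obj l) := not_nontrivial_iff_subsingleton.1 hl
    have : Subsingleton (conc B I M.toPreRep l).total :=
      ⟨fun x y => Induced.conc_ext (Subsingleton.elim _ _)⟩
    exact .of_subsingleton n

end Main

end GBP

open GBP in
theorem mainTheorem1 {k : Type u} [Field k] [IsAlgClosed k]
    {V : Type u} [Quiver.{u} V] [Fintype V] [DecidableEq V]
    (hfin : ∀ i j : V, Finite (i ⟶ j))
    (hacyclic : ∀ (i : V) (p : Quiver.Path i i), p.length = 0)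
    (A : V → Type u) [∀ i, Ring (A i)] [∀ i, Algebra k (A i)]
    (P : ∀ i, Presentation k (A i))
    (I : Set (QuiverRelation k V)) (hI : I.Finite)
    (hadm : IsAdmissible (TwoSidedIdeal.span (QuiverRelation.toPathAlgebra '' I)))
    (hpd : SimplePdCondition I)
    (M : Rep (fun i => (P i).residues) I) :
    rightPd (GBPA (fun i => (P i).residues) I) M.total
      ≤ ⨆ i ∈ M.supp, max (rightPd (A i) (M.obj i))
          (rightPd (BoundPathAlgebra I) (simpleRep I i).total) := by
  exact rightPd_total_le hacyclic hpd M
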